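/- For a lattice $\Lambda\subset\mathbb{C}$ put $g_2(\Lambda)=60\sum_{\omega\in\Lambda\setminus\{0\}}\omega^{-4}$ and $g_3(\Lambda)=140\sum_{\omega\in\Lambda\setminus\{0\}}\omega^{-6}$. Let $F_3=\{[X:Y:Z]\in\mathbb{CP}^2 : X^3+Y^3=Z^3\}$ be the Fermat cubic (the projective closure of $x^3+y^3=1$), regarded as a compact Riemann surface. There exists a lattice $\Lambda$ with $g_2(\Lambda)=0$ and $g_3(\Lambda)=8$. Let $\Lambda$ be any such lattice and let $\wp$ be its Weierstrass function, so that $(\wp')^2=4\wp^3-8$. Then: 1. There is a biholomorphism $\mathbb{C}/\Lambda\to F_3$ that is given in the affine coordinates $(x,y)=(X/Z,Y/Z)$ by $$z\mapsto\left(\frac{1}{\wp(z)}-\frac{1}{\sqrt{24}}\frac{\wp'(z)}{\wp(z)},\ \frac{1}{\wp(z)}+\frac{1}{\sqrt{24}}\frac{\wp'(z)}{\wp(z)}\right)$$ at every $z\notin\Lambda$ with $\wp(z)\neq0$. 2. For all functions $F$, $G$ meromorphic in $\mathbb{C}$ with $F^3+G^3=1$ there is an entire function $\alpha$ such that $$F=\frac{1}{\wp(\alpha)}\left(1-\frac{1}{\sqrt{24}}\wp'(\alpha)\right),\qquad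 G=\frac{1}{\wp(\alpha)}\left(1+\frac{1}{\sqrt{24}}\wp'(\alpha)\right)$$ as meromorphic functions; in particular $\alpha(z)\notin\Lambda$ and $\wp(\alpha(z))\neq0$ outside a closed discrete set of points $z$. -/

import Mathlib

open Filter Topology
open scoped Manifold ContDiff LinearAlgebra.Projectivization

noncomputable section

/-! ### The complex torus `ℂ / Λ` as a Riemann surface -/

namespace PeriodPair

variable (L : PeriodPair)

/-- The complex torus `ℂ / Λ`, with the quotient topology. -/
abbrev Torus : Type := ℂ ⧸ L.lattice

theorem isLocalHomeomorph_mkQ : IsLocalHomeomorph (L.lattice.mkQ : ℂ → L.Torus) :=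
  (L.lattice.toAddSubgroup.isAddQuotientCoveringMap_of_comm
    ⟨inferInstanceAs (DiscreteTopology L.lattice)⟩).isCoveringMap.isLocalHomeomorph

/-- The charts of `ℂ / Λ` are the local inverses of the projection `ℂ → ℂ / Λ`. -/
instance instChartedSpaceTorus : ChartedSpace ℂ L.Torus :=
  L.isLocalHomeomorph_mkQ.chartedSpace L.lattice.mkQ_surjective

theorem exists_eq_of_mem_atlas {e : OpenPartialHomeomorph L.Torus ℂ}
    (he : e ∈ atlas ℂ L.Torus) (z : ℂ) : e.symm z = L.lattice.mkQ z := by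
  obtain ⟨q, rfl⟩ := he
  simp only [OpenPartialHomeomorph.trans_symm_eq_symm_trans_symm,
    OpenPartialHomeomorph.coe_trans, Function.comp_apply,
    IsLocalHomeomorph.localInverseAt_symm]
  rfl

/-- The changes of charts of `ℂ / Λ` are locally translations by elements of `Λ`, so that `ℂ / Λ`
is a complex manifold of dimension one. -/
instance instIsManifoldTorus : IsManifold 𝓘(ℂ) ω L.Torus := by
  refine isManifold_of_contDiffOn _ _ _ fun e e' he he' ↦ ?_
  simp only [modelWithCornersSelf_coe, modelWithCornersSelf_coe_symm, Function.comp_id,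
    Function.id_comp, Set.preimage_id, Set.range_id, Set.inter_univ]
  have hopen : IsOpen (e.symm ≫ₕ e').source := (e.symm ≫ₕ e').open_source
  refine DifferentiableOn.contDiffOn (fun z hz ↦ ?_) hopen
  refine DifferentiableAt.differentiableWithinAt ?_
  have hs := L.exists_eq_of_mem_atlas he
  have hs' := L.exists_eq_of_mem_atlas he'
  have hz' : L.lattice.mkQ z ∈ e'.source := by
    have := hz
    simp only [OpenPartialHomeomorph.trans_source, Set.mem_inter_iff, Set.mem_preimage] at this
    rw [← hs]
    exact this.2
  set l : ℂ := e' (L.lattice.mkQ z) - z with hl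
  have hlm : l ∈ L.lattice := by
    have h1 := e'.left_inv hz'
    rw [hs'] at h1
    exact (Submodule.Quotient.eq L.lattice).1 h1
  have hev : ∀ᶠ w in 𝓝 z, w + l ∈ e'.target := by
    have hc : ContinuousAt (fun w : ℂ ↦ w + l) z := by fun_prop
    refine hc.eventually (e'.open_target.mem_nhds ?_)
    have : z + l = e' (L.lattice.mkQ z) := by rw [hl]; ring
    change z + l ∈ e'.target
    rw [this]
    exact e'.map_source hz'
  have heq : (e.symm ≫ₕ e' : ℂ → ℂ) =ᶠ[𝓝 z] fun w ↦ w + l := by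
    filter_upwards [hev] with w hw
    have h1 := e'.right_inv hw
    rw [hs'] at h1
    have h2 : L.lattice.mkQ (w + l) = L.lattice.mkQ w := by
      rw [map_add]
      simpa using hlm
    rw [h2] at h1
    simp only [OpenPartialHomeomorph.coe_trans, Function.comp_apply]
    rw [hs]
    exact h1
  exact (heq.differentiableAt_iff).2 (by fun_prop)

end PeriodPair

/-! ### The Fermat cubic as a Riemann surface -/

/-- The complex projective plane carries the quotient topology of `ℂ³ ∖ {0}`. -/
instance instTopologicalSpaceCP2 : TopologicalSpace (ℙ ℂ (Fin 3 → ℂ)) :=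
  inferInstanceAs (TopologicalSpace (Quotient (projectivizationSetoid ℂ (Fin 3 → ℂ))))

/-- The point `[x : y : 1]` of the projective plane with affine coordinates `(x, y)`. -/
def affinePoint (x y : ℂ) : ℙ ℂ (Fin 3 → ℂ) :=
  Projectivization.mk ℂ ![x, y, 1] fun h ↦ one_ne_zero (congrFun h 2)

/-- The homogeneous equation `X³ + Y³ = Z³` at a point `[X : Y : Z]`. -/
def FermatEquation (p : ℙ ℂ (Fin 3 → ℂ)) : Prop :=
  p.lift (fun v ↦ (v : Fin 3 → ℂ) 0 ^ 3 + (v : Fin 3 → ℂ) 1 ^ 3 =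
      (v : Fin 3 → ℂ) 2 ^ 3) (by
    rintro ⟨a, ha⟩ ⟨b, hb⟩ t rfl
    have ht : t ≠ 0 := by rintro rfl; simp at ha
    simp only [Pi.smul_apply, smul_eq_mul, mul_pow, ← mul_add, eq_iff_iff]
    exact mul_right_inj' (pow_ne_zero 3 ht))

/-- The Fermat cubic `X³ + Y³ = Z³` in the projective plane, the projective closure of
`x³ + y³ = 1`, with the subspace topology. -/
def FermatCubic : Type := {p : ℙ ℂ (Fin 3 → ℂ) // FermatEquation p}

namespace FermatCubic

instance : TopologicalSpace FermatCubic := inferInstanceAs (TopologicalSpace (Subtype _))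

/-- The point of the Fermat cubic with the homogeneous coordinates `v`. -/
def mk (v : Fin 3 → ℂ) (h0 : v ≠ 0) (hv : v 0 ^ 3 + v 1 ^ 3 = v 2 ^ 3) : FermatCubic :=
  ⟨Projectivization.mk ℂ v h0, hv⟩

theorem exists_mk (p : FermatCubic) : ∃ v h0 hv, p = mk v h0 hv := by
  obtain ⟨p, hp⟩ := p
  induction p with
  | h v h0 => exact ⟨v, h0, hp, rfl⟩

theorem mk_eq_mk (v w : Fin 3 → ℂ) (h0 hv h0' hw) (t : ℂ) (h : t • w = v) :
    mk v h0 hv = mk w h0' hw :=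
  Subtype.ext ((Projectivization.mk_eq_mk_iff' ℂ v w h0 h0').2 ⟨t, h⟩)

/-- The coefficients of `X³ + Y³ - Z³`. -/
def sgn (i : Fin 3) : ℂ := if i = 2 then -1 else 1

theorem sgn_mul_self (i : Fin 3) : sgn i * sgn i = 1 := by
  unfold sgn; split_ifs <;> norm_num

theorem equation_iff (σ : Equiv.Perm (Fin 3)) (v : Fin 3 → ℂ) :
    v 0 ^ 3 + v 1 ^ 3 = v 2 ^ 3 ↔
      sgn (σ 0) * v (σ 0) ^ 3 + sgn (σ 1) * v (σ 1) ^ 3 + sgn (σ 2) * v (σ 2) ^ 3 = 0 := by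
  have h := Equiv.sum_comp σ fun i ↦ sgn i * v i ^ 3
  simp only [Fin.sum_univ_three] at h
  rw [h]
  simp only [sgn, ← sub_eq_zero (a := v 0 ^ 3 + v 1 ^ 3)]
  simp [sub_eq_add_neg]

/-- The quotient `v k / v i` of homogeneous coordinates; it is an affine coordinate where
`v i ≠ 0`. -/
def ratio (i k : Fin 3) (p : FermatCubic) : ℂ :=
  p.1.lift (fun v ↦ (v : Fin 3 → ℂ) k / (v : Fin 3 → ℂ) i) (by
    rintro ⟨a, ha⟩ ⟨b, hb⟩ t rfl
    have ht : t ≠ 0 := by rintro rfl; simp at ha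
    simp only [Pi.smul_apply, smul_eq_mul]
    exact mul_div_mul_left _ _ ht)

@[simp] theorem ratio_mk (i k : Fin 3) (v : Fin 3 → ℂ) (h0 hv) :
    ratio i k (mk v h0 hv) = v k / v i := rfl

/-- The nonzero vectors on the cone over the cubic. -/
abbrev Cone : Type := {v : {v : Fin 3 → ℂ // v ≠ 0} // v.1 0 ^ 3 + v.1 1 ^ 3 = v.1 2 ^ 3}

theorem isOpenQuotientMap_mk' :
    IsOpenQuotientMap (fun v : {v : Fin 3 → ℂ // v ≠ 0} ↦ Projectivization.mk' ℂ v) where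
  surjective := Quotient.mk_surjective
  continuous := continuous_quot_mk
  isOpenMap := by
    intro U hU
    change IsOpen ((fun v : {v : Fin 3 → ℂ // v ≠ 0} ↦ Projectivization.mk' ℂ v) ⁻¹' _)
    have : ((fun v : {v : Fin 3 → ℂ // v ≠ 0} ↦ Projectivization.mk' ℂ v) ⁻¹'
        ((fun v ↦ Projectivization.mk' ℂ v) '' U)) =
        ⋃ a : ℂˣ, (fun v : {v : Fin 3 → ℂ // v ≠ 0} ↦
          (⟨a • v.1, (smul_ne_zero_iff_ne a).2 v.2⟩ : {v : Fin 3 → ℂ // v ≠ 0})) ⁻¹' U := by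
      ext v
      simp only [Set.mem_preimage, Set.mem_image, Projectivization.mk'_eq_mk, Set.mem_iUnion]
      constructor
      · rintro ⟨w, hw, h⟩
        obtain ⟨a, ha⟩ := (Projectivization.mk_eq_mk_iff ℂ _ _ _ _).1 h
        refine ⟨a, ?_⟩
        have : (⟨a • v.1, (smul_ne_zero_iff_ne a).2 v.2⟩ : {v : Fin 3 → ℂ // v ≠ 0}) = w :=
          Subtype.ext ha
        rwa [this]
      · rintro ⟨a, ha⟩
        exact ⟨_, ha, (Projectivization.mk_eq_mk_iff ℂ _ _ _ _).2 ⟨a, rfl⟩⟩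
    rw [this]
    refine isOpen_iUnion fun a ↦ hU.preimage ?_
    exact Continuous.subtype_mk (continuous_subtype_val.const_smul a) _

theorem isQuotientMap_mk :
    IsQuotientMap (fun v : Cone ↦ mk v.1.1 v.1.2 v.2) := by
  have h := (isOpenQuotientMap_mk'.restrictPreimage {p | FermatEquation p}).isQuotientMap
  exact h

theorem continuous_coord (i : Fin 3) : Continuous fun v : Cone ↦ v.1.1 i :=
  (continuous_apply i).comp (continuous_subtype_val.comp continuous_subtype_val)

theorem isOpen_ne_zero (i : Fin 3) : IsOpen {p : FermatCubic | ratio i i p ≠ 0} := by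
  rw [← isQuotientMap_mk.isOpen_preimage]
  have : (fun v : Cone ↦ mk v.1.1 v.1.2 v.2) ⁻¹' {p | ratio i i p ≠ 0} =
      {v : Cone | v.1.1 i ≠ 0} := by
    ext v
    simp
  rw [this]
  exact isOpen_ne_fun (continuous_coord i) continuous_const

theorem continuousOn_ratio (i k : Fin 3) :
    ContinuousOn (ratio i k) {p : FermatCubic | ratio i i p ≠ 0} := by
  rw [isQuotientMap_mk.continuousOn_isOpen_iff (isOpen_ne_zero i)]
  have : ratio i k ∘ (fun v : Cone ↦ mk v.1.1 v.1.2 v.2) = fun v ↦ v.1.1 k / v.1.1 i := rfl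
  rw [this]
  refine ContinuousOn.div (continuous_coord k).continuousOn
    (continuous_coord i).continuousOn fun v hv ↦ ?_
  simpa using hv

/-- The open sector `|arg w| < π / 3`, on which `w ↦ w³` is injective with image the slit plane. -/
def sector : Set ℂ := {w | w ∈ Complex.slitPlane ∧ |w.arg| < Real.pi / 3}

theorem isOpen_sector : IsOpen sector := by
  have h : ContinuousOn (fun w : ℂ ↦ |w.arg|) Complex.slitPlane := fun w hw ↦
    (Complex.continuousAt_arg hw).abs.continuousWithinAt
  exact h.isOpen_inter_preimage Complex.isOpen_slitPlane isOpen_Iio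

theorem one_mem_sector : (1 : ℂ) ∈ sector := by
  refine ⟨Complex.one_mem_slitPlane, ?_⟩
  simp [Real.pi_pos]

theorem ne_zero_of_mem_sector {w : ℂ} (hw : w ∈ sector) : w ≠ 0 :=
  Complex.slitPlane_ne_zero hw.1

theorem cpow_pow_of_mem_sector {w : ℂ} (hw : w ∈ sector) : (w ^ 3) ^ ((3 : ℕ)⁻¹ : ℂ) = w := by
  have := abs_lt.1 hw.2
  exact Complex.pow_cpow_nat_inv (by norm_num) (by push_cast; exact this.1)
    (by push_cast; exact this.2.le)

theorem pow_mem_slitPlane {w : ℂ} (hw : w ∈ sector) : w ^ 3 ∈ Complex.slitPlane := by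
  have h0 := ne_zero_of_mem_sector hw
  have h := abs_lt.1 hw.2
  refine Complex.mem_slitPlane_iff_arg.2 ⟨?_, pow_ne_zero 3 h0⟩
  have h1 : (3 * w.arg : ℝ) ∈ Set.Ioc (-Real.pi) Real.pi := ⟨by linarith [h.1], by linarith [h.2]⟩
  have h2 : (w ^ 3).arg = 3 * w.arg := by
    rw [← Complex.arg_coe_angle_toReal_eq_arg, Complex.arg_pow_coe_angle]
    have : (3 : ℕ) • (w.arg : Real.Angle) = ((3 * w.arg : ℝ) : Real.Angle) := by
      rw [← Real.Angle.coe_nsmul]; simp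
    rw [this]
    exact (Real.Angle.toReal_coe_eq_self_iff).2 h1
  rw [h2]
  linarith [h.2]

theorem cpow_mem_sector {c : ℂ} (hc : c ∈ Complex.slitPlane) :
    c ^ ((3 : ℕ)⁻¹ : ℂ) ∈ sector := by
  obtain ⟨h1, h2⟩ := Complex.mem_slitPlane_iff_arg.1 hc
  have h3 : c ^ ((3 : ℕ)⁻¹ : ℂ) = ((‖c‖ ^ (3⁻¹ : ℝ) : ℝ) : ℂ) *
      (Complex.cos ((c.arg / 3 : ℝ) : ℂ) + Complex.sin ((c.arg / 3 : ℝ) : ℂ) * Complex.I) := by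
    rw [Complex.cpow_def_of_ne_zero h2, Complex.log, Real.rpow_def_of_pos (norm_pos_iff.2 h2)]
    rw [← Complex.exp_mul_I, Complex.ofReal_exp, ← Complex.exp_add]
    congr 1
    push_cast
    ring
  have hlo := Complex.neg_pi_lt_arg c
  have hhi := lt_of_le_of_ne (Complex.arg_le_pi c) h1
  have hpos : 0 < ‖c‖ ^ (3⁻¹ : ℝ) := Real.rpow_pos_of_pos (norm_pos_iff.2 h2) _
  have harg : (c ^ ((3 : ℕ)⁻¹ : ℂ)).arg = c.arg / 3 := by
    rw [h3]
    exact Complex.arg_mul_cos_add_sin_mul_I hpos ⟨by linarith [Real.pi_pos], by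
      linarith [Real.pi_pos]⟩
  refine ⟨Complex.mem_slitPlane_iff_arg.2 ⟨?_, ?_⟩, ?_⟩
  · rw [harg]; linarith [Real.pi_pos]
  · simp [Complex.cpow_eq_zero_iff, h2]
  · rw [harg, abs_lt]; constructor <;> linarith [Real.pi_pos]

/-- The value of `(s / s₀)³` on the cubic, where `t = v (σ 2) / v (σ 0)` and
`s = v (σ 1) / v (σ 0)`. -/
def cube (σ : Equiv.Perm (Fin 3)) (s₀ t : ℂ) : ℂ :=
  -(sgn (σ 1) * (sgn (σ 0) + sgn (σ 2) * t ^ 3)) / s₀ ^ 3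

/-- The homogeneous coordinates of the point of the cubic with `v (σ 0) = 1`, `v (σ 2) = t` and
`v (σ 1)` in the sector around `s₀`. -/
def chartVec (σ : Equiv.Perm (Fin 3)) (s₀ t : ℂ) (i : Fin 3) : ℂ :=
  ![1, s₀ * cube σ s₀ t ^ ((3 : ℕ)⁻¹ : ℂ), t] (σ.symm i)

@[simp] theorem chartVec_zero (σ s₀ t) : chartVec σ s₀ t (σ 0) = 1 := by simp [chartVec]
@[simp] theorem chartVec_one (σ s₀ t) :
    chartVec σ s₀ t (σ 1) = s₀ * cube σ s₀ t ^ ((3 : ℕ)⁻¹ : ℂ) := by simp [chartVec]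
@[simp] theorem chartVec_two (σ s₀ t) : chartVec σ s₀ t (σ 2) = t := by simp [chartVec]

theorem chartVec_ne_zero (σ s₀ t) : chartVec σ s₀ t ≠ 0 := fun h ↦ by
  have := congrFun h (σ 0)
  simp at this

theorem chartVec_equation (σ) {s₀ : ℂ} (hs : s₀ ≠ 0) (t : ℂ) :
    chartVec σ s₀ t 0 ^ 3 + chartVec σ s₀ t 1 ^ 3 = chartVec σ s₀ t 2 ^ 3 := by
  rw [equation_iff σ, chartVec_zero, chartVec_one, chartVec_two, mul_pow,
    Complex.cpow_nat_inv_pow _ (by norm_num : (3 : ℕ) ≠ 0), cube]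
  field_simp
  linear_combination (-(sgn (σ 0) + sgn (σ 2) * t ^ 3)) * sgn_mul_self (σ 1)

theorem cube_eq (σ : Equiv.Perm (Fin 3)) (s₀ : ℂ) (v : Fin 3 → ℂ)
    (hv : v 0 ^ 3 + v 1 ^ 3 = v 2 ^ 3) (h0 : v (σ 0) ≠ 0) :
    cube σ s₀ (v (σ 2) / v (σ 0)) = (v (σ 1) / v (σ 0) / s₀) ^ 3 := by
  rw [equation_iff σ] at hv
  rw [cube, div_pow _ s₀]
  congr 1
  field_simp
  linear_combination (-sgn (σ 1)) * hv + v (σ 1) ^ 3 * sgn_mul_self (σ 1)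

theorem ne_zero_of_div_mem_sector {a b s : ℂ} (h : a / b / s ∈ sector) : b ≠ 0 := by
  rintro rfl
  exact ne_zero_of_mem_sector h (by simp)

/-- The holomorphic charts of the Fermat cubic: for the homogeneous coordinates `a = v (σ 0)`,
`b = v (σ 1)`, `c = v (σ 2)` in any order and `s₀ ≠ 0`, the affine coordinate `c / a` on the open
set of the points with `a ≠ 0` and `b / a` in the sector around `s₀`. -/
def chart (σ : Equiv.Perm (Fin 3)) (s₀ : ℂ) (hs : s₀ ≠ 0) :
    OpenPartialHomeomorph FermatCubic ℂ where
  toFun := ratio (σ 0) (σ 2)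
  invFun t := mk (chartVec σ s₀ t) (chartVec_ne_zero σ s₀ t) (chartVec_equation σ hs t)
  source := {p | ratio (σ 0) (σ 1) p / s₀ ∈ sector}
  target := {t | cube σ s₀ t ∈ Complex.slitPlane}
  map_source' p hp := by
    obtain ⟨v, h0, hv, rfl⟩ := exists_mk p
    simp only [ratio_mk, Set.mem_ofPred_eq] at hp ⊢
    rw [cube_eq σ s₀ v hv (ne_zero_of_div_mem_sector hp)]
    exact pow_mem_slitPlane hp
  map_target' t ht := by
    simp only [ratio_mk, chartVec_zero, chartVec_one, Set.mem_ofPred_eq, div_one]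
    rw [mul_div_cancel_left₀ _ hs]
    exact cpow_mem_sector ht
  left_inv' p hp := by
    obtain ⟨v, h0, hv, rfl⟩ := exists_mk p
    simp only [ratio_mk, Set.mem_ofPred_eq] at hp ⊢
    have ha := ne_zero_of_div_mem_sector hp
    refine mk_eq_mk _ _ _ _ _ _ (v (σ 0))⁻¹ ?_
    funext i
    obtain ⟨j, rfl⟩ := σ.surjective i
    fin_cases j
    · simp [ha]
    · simp only [Pi.smul_apply, smul_eq_mul, Fin.mk_one, chartVec_one]
      rw [cube_eq σ s₀ v hv ha, cpow_pow_of_mem_sector hp]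
      field_simp
    · simp [div_eq_inv_mul]
  right_inv' t _ := by simp
  open_source := by
    have h := ((continuousOn_ratio (σ 0) (σ 1)).div_const s₀).isOpen_inter_preimage
      (isOpen_ne_zero (σ 0)) isOpen_sector
    convert! h using 1
    ext p
    simp only [Set.mem_ofPred_eq, Set.mem_inter_iff, Set.mem_preimage, iff_and_self]
    intro hp
    obtain ⟨v, h0, hv, rfl⟩ := exists_mk p
    have ha := ne_zero_of_div_mem_sector hp
    simp [ha]
  open_target := Complex.isOpen_slitPlane.preimage (by unfold cube; fun_prop)
  continuousOn_toFun := by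
    refine (continuousOn_ratio (σ 0) (σ 2)).mono fun p hp ↦ ?_
    obtain ⟨v, h0, hv, rfl⟩ := exists_mk p
    have ha := ne_zero_of_div_mem_sector hp
    simp [ha]
  continuousOn_invFun := by
    have h : ContinuousOn (fun t ↦ (⟨⟨chartVec σ s₀ t, chartVec_ne_zero σ s₀ t⟩,
        chartVec_equation σ hs t⟩ : Cone)) {t | cube σ s₀ t ∈ Complex.slitPlane} := by
      refine (Topology.IsInducing.subtypeVal.comp Topology.IsInducing.subtypeVal).continuousOn_iff.2
        (continuousOn_pi.2 ?_)
      intro i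
      obtain ⟨j, rfl⟩ := σ.surjective i
      fin_cases j
      · simpa [Function.comp_def] using continuousOn_const
      · simp only [Function.comp_def, Fin.mk_one, chartVec_one]
        refine continuousOn_const.mul (ContinuousOn.cpow_const ?_ fun t ht ↦ ht)
        unfold cube
        fun_prop
      · simp only [Function.comp_def, Fin.reduceFinMk, chartVec_two]
        exact continuousOn_id
    exact isQuotientMap_mk.continuous.comp_continuousOn h

theorem exists_mem_chart_source (p : FermatCubic) : ∃ σ s₀ hs, p ∈ (chart σ s₀ hs).source := by
  obtain ⟨v, h0, hv, rfl⟩ := exists_mk p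
  obtain ⟨σ, ha, hb⟩ : ∃ σ : Equiv.Perm (Fin 3), v (σ 0) ≠ 0 ∧ v (σ 1) ≠ 0 := by
    by_contra! H
    apply h0
    by_cases h00 : v 0 = 0
    · by_cases h1 : v 1 = 0
      · rw [h00, h1] at hv
        have h2 : v 2 = 0 := by simpa using hv.symm
        funext i
        fin_cases i <;> simp [h00, h1, h2]
      · have h2 := H (Equiv.swap 0 1 * Equiv.swap 1 2) (by
          have : (Equiv.swap 0 1 * Equiv.swap 1 2 : Equiv.Perm (Fin 3)) 0 = 1 := by decide
          rw [this]; exact h1)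
        have : (Equiv.swap 0 1 * Equiv.swap 1 2 : Equiv.Perm (Fin 3)) 1 = 2 := by decide
        rw [this] at h2
        rw [h00, h2] at hv
        exact absurd (by simpa using hv) h1
    · have h1 : v 1 = 0 := H 1 h00
      have h2 := H (Equiv.swap 1 2) h00
      have : (Equiv.swap 1 2 : Equiv.Perm (Fin 3)) 1 = 2 := by decide
      rw [this] at h2
      rw [h1, h2] at hv
      exact absurd (by simpa using hv) h00
  refine ⟨σ, v (σ 1) / v (σ 0), div_ne_zero hb ha, ?_⟩
  change v (σ 1) / v (σ 0) / (v (σ 1) / v (σ 0)) ∈ sector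
  rw [div_self (div_ne_zero hb ha)]
  exact one_mem_sector

instance : ChartedSpace ℂ FermatCubic where
  atlas := {e | ∃ σ s₀ hs, e = chart σ s₀ hs}
  chartAt p := chart _ _ (exists_mem_chart_source p).choose_spec.choose_spec.choose
  mem_chart_source p := (exists_mem_chart_source p).choose_spec.choose_spec.choose_spec
  chart_mem_atlas _ := ⟨_, _, _, rfl⟩

/-- The changes of charts are holomorphic, so that the Fermat cubic is a complex manifold of
dimension one. -/
instance : IsManifold 𝓘(ℂ) ω FermatCubic := by
  refine isManifold_of_contDiffOn _ _ _ ?_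
  rintro _ _ ⟨σ, s₀, hs, rfl⟩ ⟨σ', s₀', hs', rfl⟩
  simp only [modelWithCornersSelf_coe, modelWithCornersSelf_coe_symm, Function.comp_id,
    Function.id_comp, Set.preimage_id, Set.range_id, Set.inter_univ]
  refine DifferentiableOn.contDiffOn ?_
    ((chart σ s₀ hs).symm ≫ₕ chart σ' s₀' hs').open_source
  have hd : ∀ i, DifferentiableOn ℂ (fun t ↦ chartVec σ s₀ t i)
      ((chart σ s₀ hs).symm ≫ₕ chart σ' s₀' hs').source := by
    intro i
    obtain ⟨j, rfl⟩ := σ.surjective i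
    fin_cases j
    · simp
    · simp only [Fin.mk_one, chartVec_one]
      refine (differentiableOn_const _).mul (DifferentiableOn.cpow_const ?_ fun t ht ↦ ht.1)
      unfold cube
      fun_prop
    · simp only [Fin.reduceFinMk, chartVec_two]
      exact differentiableOn_id
  change DifferentiableOn ℂ (fun t ↦ chartVec σ s₀ t (σ' 2) / chartVec σ s₀ t (σ' 0)) _
  refine (hd _).div (hd _) fun t ht ↦ ?_
  have h : chartVec σ s₀ t (σ' 1) / chartVec σ s₀ t (σ' 0) / s₀' ∈ sector := ht.2
  exact ne_zero_of_div_mem_sector h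

end FermatCubic

end

/-! With `g₂ = 0` and `g₃ = 8`, put `a = ℘' / √24`. Then `(1 - a)³ + (1 + a)³ = 2 + 6a² = 2 + ℘'² /
4 = ℘³`, so `z ↦ [1 - a : 1 + a : ℘]` maps `ℂ ∖ Λ` into the cubic. Clearing the pole extends the map
to `Λ` with the value `[-1 : 1 : 0]`. It descends to a bijection of the torus because `(℘, ℘')` is
injective modulo `Λ` (`sub_mem_lattice_of_eq`) and hits every point of `q² = 4p³ - g₂p - g₃`
(`exists_weierstrassP_eq_and_derivWeierstrassP_eq`). The first fact is uniqueness for `℘'' = 6℘² -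
g₂ / 2`; the second is Liouville's theorem. The inverse is holomorphic since the Wronskians of the
homogeneous coordinates do not vanish where they matter (`exists_local_section_toFermat`).

For the second claim, `[F : G : 1]` extends across poles to a holomorphic map of `ℂ` into the cubic
(`exists_contMDiff_of_meromorphic`). Carried to the torus by the inverse biholomorphism, it lifts
through the covering `ℂ → ℂ / Λ` because `ℂ` is simply connected; the lift is `α`.

The lattice is a multiple of the hexagonal one: the symmetry of order three kills `g₂`, then `g₃ ≠
0`, and scaling makes `g₃ = 8`. -/

noncomputable section

/-! ### Uniqueness principles -/

/-- A solution of a linear homogeneous second order equation with vanishing initial values is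
zero. -/
theorem eventually_eq_zero_of_deriv_deriv_eq_mul {h k : ℂ → ℂ} {x : ℂ} (hh : AnalyticAt ℂ h x)
    (hk : AnalyticAt ℂ k x) (hx : h x = 0) (hx' : deriv h x = 0)
    (hd : deriv (deriv h) =ᶠ[𝓝 x] k * h) : ∀ᶠ z in 𝓝 x, h z = 0 := by
  rw [← analyticOrderAt_eq_top]
  -- Two differentiations lower a finite order of vanishing by two, whereas `k * h` vanishes at
  -- least to the order of `h`.
  have h1 := hh.analyticOrderAt_deriv_add_one
  have h2 := hh.deriv.analyticOrderAt_deriv_add_one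
  simp only [hx, hx', sub_zero] at h1 h2
  rw [analyticOrderAt_congr hd, analyticOrderAt_mul hk hh] at h2
  by_contra hn
  obtain ⟨n, hn⟩ := ENat.ne_top_iff_exists.1 hn
  have h3 : ((n + 2 : ℕ) : ℕ∞) ≤ n := by
    calc ((n + 2 : ℕ) : ℕ∞) = analyticOrderAt h x + 1 + 1 := by rw [← hn]; norm_cast
      _ ≤ analyticOrderAt k x + analyticOrderAt h x + 1 + 1 := by gcongr; exact le_add_self
      _ = n := by rw [h2, h1, hn]
  norm_cast at h3
  omega

/-- The identity theorem: infinite order of `f - g` at one point propagates over the connected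
plane. It carries local uniqueness for the differential equation to the poles of `℘`. -/
theorem Meromorphic.eventually_nhdsNE_eq_of_eventually_nhds_eq {f g : ℂ → ℂ} (hf : Meromorphic f)
    (hg : Meromorphic g) {z : ℂ} (h : ∀ᶠ w in 𝓝 z, f w = g w) (w : ℂ) :
    ∀ᶠ v in 𝓝[≠] w, f v = g v := by
  have h1 : Meromorphic (f - g) := hf.sub hg
  have h2 : meromorphicOrderAt (f - g) z = ⊤ := by
    rw [meromorphicOrderAt_eq_top_iff]
    filter_upwards [mem_nhdsWithin_of_mem_nhds h] with v hv
    simpa [sub_eq_zero] using hv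
  have h3 : meromorphicOrderAt (f - g) w = ⊤ := by
    by_contra hne
    exact h1.exists_meromorphicOrderAt_ne_top_iff_forall.1 ⟨w, hne⟩ z h2
  rw [meromorphicOrderAt_eq_top_iff] at h3
  filter_upwards [h3] with v hv
  simpa [sub_eq_zero] using hv

/-! ### Differential equations, injectivity and values of `(℘, ℘')` -/

namespace PeriodPair

variable (L : PeriodPair)

theorem isOpen_compl_lattice : IsOpen (L.lattice : Set ℂ)ᶜ := L.isClosed_lattice.isOpen_compl

theorem analyticAt_weierstrassP {z : ℂ} (hz : z ∉ L.lattice) : AnalyticAt ℂ L.weierstrassP z :=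
  L.analyticOnNhd_weierstrassP z hz

theorem analyticAt_derivWeierstrassP {z : ℂ} (hz : z ∉ L.lattice) :
    AnalyticAt ℂ L.derivWeierstrassP z :=
  L.analyticOnNhd_derivWeierstrassP z hz

theorem hasDerivAt_weierstrassP {z : ℂ} (hz : z ∉ L.lattice) :
    HasDerivAt L.weierstrassP (L.derivWeierstrassP z) z := by
  have := (L.analyticAt_weierstrassP hz).differentiableAt.hasDerivAt
  rwa [L.deriv_weierstrassP] at this

theorem meromorphicOrderAt_derivWeierstrassP_ne_top (z : ℂ) :
    meromorphicOrderAt L.derivWeierstrassP z ≠ ⊤ := by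
  revert z
  refine (L.meromorphic_derivWeierstrassP.exists_meromorphicOrderAt_ne_top_iff_forall).1
    ⟨0, ?_⟩
  rw [← L.deriv_weierstrassP, meromorphicOrderAt_deriv_eq_sub_one (n := -2) (by norm_num)
    (by rw [L.order_weierstrassP 0 (zero_mem _)]; rfl)]
  simp

/-- Differentiating `℘'² = 4℘³ - g₂℘ - g₃` gives this equation multiplied by `℘'`. Since `℘'` has no
zeros in a punctured neighbourhood, it cancels there, and continuity recovers the point itself. -/
theorem hasDerivAt_derivWeierstrassP {z : ℂ} (hz : z ∉ L.lattice) :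
    HasDerivAt L.derivWeierstrassP (6 * L.weierstrassP z ^ 2 - L.g₂ / 2) z := by
  have hmul : ∀ w ∉ L.lattice, L.derivWeierstrassP w *
      (deriv L.derivWeierstrassP w - (6 * L.weierstrassP w ^ 2 - L.g₂ / 2)) = 0 := by
    intro w hw
    have h1 := ((L.analyticAt_derivWeierstrassP hw).differentiableAt.hasDerivAt).pow 2
    have h2 := (((L.hasDerivAt_weierstrassP hw).pow 3).const_mul 4).sub
      ((L.hasDerivAt_weierstrassP hw).const_mul L.g₂) |>.sub_const L.g₃
    have h3 := h1.unique (h2.congr_of_eventuallyEq ?_)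
    · simp only [Nat.cast_ofNat, Nat.add_one_sub_one, pow_one] at h3
      linear_combination h3 / 2
    · filter_upwards [L.isOpen_compl_lattice.mem_nhds hw] with v hv
      exact L.derivWeierstrassP_sq v hv
  have hne := (meromorphicOrderAt_ne_top_iff_eventually_ne_zero
    (L.meromorphic_derivWeierstrassP z)).1 (L.meromorphicOrderAt_derivWeierstrassP_ne_top z)
  have hc : ContinuousAt (fun w ↦ deriv L.derivWeierstrassP w -
      (6 * L.weierstrassP w ^ 2 - L.g₂ / 2)) z := by
    have h1 := (L.analyticAt_derivWeierstrassP hz).deriv.continuousAt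
    have h2 := (L.analyticAt_weierstrassP hz).continuousAt
    fun_prop
  have h0 : deriv L.derivWeierstrassP z - (6 * L.weierstrassP z ^ 2 - L.g₂ / 2) = 0 := by
    refine tendsto_nhds_unique (l := 𝓝[≠] z) (hc.tendsto.mono_left nhdsWithin_le_nhds)
      (tendsto_const_nhds.congr' (f₁ := fun _ ↦ (0 : ℂ)) ?_)
    filter_upwards [hne, mem_nhdsWithin_of_mem_nhds (L.isOpen_compl_lattice.mem_nhds hz)]
      with w hw hw'
    exact ((mul_eq_zero.1 (hmul w hw')).resolve_left hw).symm
  rw [← sub_eq_zero.1 h0]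
  exact (L.analyticAt_derivWeierstrassP hz).differentiableAt.hasDerivAt

/-- A solution of the second order equation of `℘` with the initial values of `℘` at `z` is
equal to `℘`. -/
theorem eventually_eq_weierstrassP {f : ℂ → ℂ} {z : ℂ} (hz : z ∉ L.lattice)
    (hf : AnalyticAt ℂ f z) (h0 : f z = L.weierstrassP z) (h1 : deriv f z = L.derivWeierstrassP z)
    (hd : ∀ᶠ w in 𝓝 z, deriv (deriv f) w = 6 * f w ^ 2 - L.g₂ / 2) :
    ∀ᶠ w in 𝓝 z, f w = L.weierstrassP w := by
  have hP := L.analyticAt_weierstrassP hz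
  have hPe : ∀ᶠ w in 𝓝 z, w ∉ L.lattice := L.isOpen_compl_lattice.mem_nhds hz
  have hev : ∀ᶠ w in 𝓝 z, deriv (f - L.weierstrassP) w = deriv f w - L.derivWeierstrassP w := by
    filter_upwards [hf.eventually_analyticAt, hPe] with w hw hw'
    rw [deriv_sub hw.differentiableAt (L.analyticAt_weierstrassP hw').differentiableAt,
      L.deriv_weierstrassP]
  -- The difference of two solutions satisfies the linear equation `h'' = 6 (f + ℘) h`.
  have := eventually_eq_zero_of_deriv_deriv_eq_mul (h := f - L.weierstrassP)
    (k := fun w ↦ 6 * (f w + L.weierstrassP w)) (hf.sub hP) (by fun_prop) (by simp [h0])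
    (by rw [hev.self_of_nhds, h1, sub_self]) ?_
  · filter_upwards [this] with w hw using sub_eq_zero.1 hw
  · filter_upwards [hev.eventually_nhds, hd, hPe, hf.eventually_analyticAt] with w hw hw1 hw2 hw3
    rw [EventuallyEq.deriv_eq hw, deriv_fun_sub hw3.deriv.differentiableAt
      (L.analyticAt_derivWeierstrassP hw2).differentiableAt, hw1,
      (L.hasDerivAt_derivWeierstrassP hw2).deriv]
    simp only [Pi.mul_apply, Pi.sub_apply]
    ring

/-- The pair `(℘, ℘')` is injective on `ℂ / Λ`. -/
theorem sub_mem_lattice_of_eq {z w : ℂ} (hz : z ∉ L.lattice) (hw : w ∉ L.lattice)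
    (h0 : L.weierstrassP z = L.weierstrassP w)
    (h1 : L.derivWeierstrassP z = L.derivWeierstrassP w) : z - w ∈ L.lattice := by
  set c := z - w with hc
  have hwc : w + c = z := by rw [hc]; ring
  have hev : ∀ᶠ v in 𝓝 w, v + c ∉ L.lattice := by
    have : ContinuousAt (fun v : ℂ ↦ v + c) w := by fun_prop
    exact this.eventually (L.isOpen_compl_lattice.mem_nhds (by simpa only [hwc] using! hz))
  have hder : ∀ v, v + c ∉ L.lattice →
      HasDerivAt (fun v ↦ L.weierstrassP (v + c)) (L.derivWeierstrassP (v + c)) v :=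
    fun v hv ↦ (L.hasDerivAt_weierstrassP hv).comp_add_const v c
  have hloc := L.eventually_eq_weierstrassP (f := fun v ↦ L.weierstrassP (v + c)) hw ?_
    (by simpa only [hwc] using h0) ?_ ?_
  · have hm : Meromorphic fun v ↦ L.weierstrassP (v + c) := fun v ↦
      (L.meromorphic_weierstrassP (v + c)).comp_analyticAt (f := L.weierstrassP)
        (g := fun v ↦ v + c) (by fun_prop)
    -- The translate by `c` now agrees with `℘` near `0`, where `℘` has a pole; it would be analytic
    -- there if `c` were not a period.
    have h2 := Meromorphic.eventually_nhdsNE_eq_of_eventually_nhds_eq hm L.meromorphic_weierstrassP hloc 0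
    have h3 := meromorphicOrderAt_congr h2
    by_contra hcm
    have h4 : AnalyticAt ℂ (fun v ↦ L.weierstrassP (v + c)) 0 :=
      AnalyticAt.fun_comp (g := L.weierstrassP) (f := fun v ↦ v + c)
        (L.analyticAt_weierstrassP (by simpa using hcm)) (by fun_prop)
    have h5 := h4.meromorphicOrderAt_nonneg
    rw [h3, L.order_weierstrassP 0 (zero_mem _)] at h5
    exact absurd h5 (by decide)
  · exact AnalyticAt.fun_comp (g := L.weierstrassP) (f := fun v ↦ v + c)
      (L.analyticAt_weierstrassP (by rwa [hwc])) (by fun_prop)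
  · rw [(hder w (by rwa [hwc])).deriv, hwc, h1]
  · filter_upwards [hev.eventually_nhds] with v hv
    have : deriv (fun v ↦ L.weierstrassP (v + c)) =ᶠ[𝓝 v] fun v ↦ L.derivWeierstrassP (v + c) := by
      filter_upwards [hv] with u hu using (hder u hu).deriv
    rw [this.deriv_eq]
    exact ((L.hasDerivAt_derivWeierstrassP hv.self_of_nhds).comp_add_const v c).deriv

theorem add_mem_lattice_iff {z l : ℂ} (hl : l ∈ L.lattice) : z + l ∈ L.lattice ↔ z ∈ L.lattice :=
  L.lattice.toAddSubgroup.add_mem_cancel_right hl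

/-- If `c` were omitted, `1 / (℘ - c)`, extended by `0` at the poles, would be entire and periodic,
hence bounded and constant. It vanishes at `0` but not at `ω₁ / 2`. -/
theorem exists_weierstrassP_eq (c : ℂ) : ∃ z ∉ L.lattice, L.weierstrassP z = c := by
  classical
  by_contra! H
  set g : ℂ → ℂ := fun z ↦ if z ∈ L.lattice then 0 else (L.weierstrassP z - c)⁻¹ with hg
  have hdiff : ∀ z ∉ L.lattice, DifferentiableAt ℂ g z := by
    intro z hz
    have h1 : DifferentiableAt ℂ (fun z ↦ (L.weierstrassP z - c)⁻¹) z :=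
      ((L.analyticAt_weierstrassP hz).differentiableAt.sub_const c).inv (sub_ne_zero.2 (H z hz))
    refine h1.congr_of_eventuallyEq ?_
    filter_upwards [L.isOpen_compl_lattice.mem_nhds hz] with w hw
    exact if_neg hw
  have hpunct : ∀ l ∈ L.lattice, ∀ᶠ z in 𝓝[≠] l, z ∉ L.lattice := by
    intro l hl
    filter_upwards [self_mem_nhdsWithin, mem_nhdsWithin_of_mem_nhds
      (L.compl_lattice_sdiff_singleton_mem_nhds l)] with w hw hw'
    simp_all
  have hD : Differentiable ℂ g := by
    intro l
    by_cases hl : l ∈ L.lattice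
    swap
    · exact hdiff l hl
    refine (Complex.analyticAt_of_differentiable_on_punctured_nhds_of_continuousAt
      (by filter_upwards [hpunct l hl] with z hz using hdiff z hz) ?_).differentiableAt
    rw [continuousAt_iff_punctured_nhds]
    have hgl : g l = 0 := by simp [hg, hl]
    rw [hgl]
    have h1 := tendsto_cobounded_of_meromorphicOrderAt_neg (f := L.weierstrassP) (x := l)
      (by rw [L.order_weierstrassP l hl]; decide)
    have h2 : Tendsto (fun z ↦ L.weierstrassP z - c) (𝓝[≠] l) (Bornology.cobounded ℂ) := by
      exact (tendsto_sub_const_cobounded c).comp h1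
    refine (tendsto_inv₀_cobounded.comp h2).congr' ?_
    filter_upwards [hpunct l hl] with z hz
    simp [hg, hz]
  have hper : ∀ z w, w ∈ L.lattice → g (z + w) = g z := by
    intro z w hw
    have := L.weierstrassP_add_coe z ⟨w, hw⟩
    simp only at this
    simp only [hg, L.add_mem_lattice_iff hw, this]
  have hconst := hD.apply_eq_apply_of_bounded
    (IsZLattice.isCompact_range_of_periodic L.lattice _ hD.continuous hper).isBounded
    (L.ω₁ / 2) 0
  have h0 : g 0 = 0 := by simp [hg]
  rw [h0] at hconst
  simp only [hg, if_neg L.ω₁_div_two_notMem_lattice, inv_eq_zero] at hconst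
  exact H _ L.ω₁_div_two_notMem_lattice (sub_eq_zero.1 hconst)

/-- A preimage of `p` under `℘` fixes `℘'` up to sign, and `z ↦ -z` changes the sign. -/
theorem exists_weierstrassP_eq_and_derivWeierstrassP_eq {p q : ℂ}
    (h : q ^ 2 = 4 * p ^ 3 - L.g₂ * p - L.g₃) :
    ∃ z ∉ L.lattice, L.weierstrassP z = p ∧ L.derivWeierstrassP z = q := by
  obtain ⟨z, hz, rfl⟩ := L.exists_weierstrassP_eq p
  rw [← L.derivWeierstrassP_sq z hz, sq_eq_sq_iff_eq_or_eq_neg] at h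
  rcases h with h | h
  · exact ⟨z, hz, rfl, h.symm⟩
  · exact ⟨-z, by simpa using hz, by simp, by simp [h]⟩

/-- At the half period `ω₁ / 2` the odd periodic function `℘'` vanishes. If both invariants were
zero, so would `℘` there, and uniqueness for `f'' = 6f²` would make `℘` identically zero, against
its pole. -/
theorem g₂_ne_zero_or_g₃_ne_zero : L.g₂ ≠ 0 ∨ L.g₃ ≠ 0 := by
  by_contra! H
  have hz := L.ω₁_div_two_notMem_lattice
  have h1 : L.derivWeierstrassP (L.ω₁ / 2) = 0 := by
    rw [← CharZero.eq_neg_self_iff, ← L.derivWeierstrassP_neg,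
      ← L.derivWeierstrassP_add_coe (-(L.ω₁ / 2)) ⟨L.ω₁, L.ω₁_mem_lattice⟩]
    congr 1
    ring
  have h2 : L.weierstrassP (L.ω₁ / 2) = 0 := by
    have := L.derivWeierstrassP_sq _ hz
    simpa [h1, H.1, H.2] using this.symm
  have h3 := L.eventually_eq_weierstrassP (f := fun _ ↦ 0) hz analyticAt_const h2.symm
    (by simp [h1]) (by simp [H.1])
  have h4 := Meromorphic.eventually_nhdsNE_eq_of_eventually_nhds_eq (f := fun _ ↦ (0 : ℂ))
    (fun _ ↦ analyticAt_const.meromorphicAt) L.meromorphic_weierstrassP h3 0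
  have h5 := meromorphicOrderAt_congr h4
  rw [L.order_weierstrassP 0 (zero_mem _)] at h5
  have h6 := (analyticAt_const (𝕜 := ℂ) (v := (0 : ℂ)) (x := (0 : ℂ))).meromorphicOrderAt_nonneg
  rw [h5] at h6
  exact absurd h6 (by decide)

/-! ### Scaling and the hexagonal lattice -/

/-- The pair of periods `c ω₁, c ω₂`. -/
@[simps] def smul {c : ℂ} (hc : c ≠ 0) : PeriodPair where
  ω₁ := c * L.ω₁
  ω₂ := c * L.ω₂
  indep := by
    have := L.indep.map' (LinearMap.mulLeft ℝ c) (LinearMap.ker_eq_bot.2 (mul_right_injective₀ hc))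
    have h : ![c * L.ω₁, c * L.ω₂] = LinearMap.mulLeft ℝ c ∘ ![L.ω₁, L.ω₂] := by
      funext i
      fin_cases i <;> simp
    rw [h]
    exact this

theorem mem_lattice_smul {c : ℂ} (hc : c ≠ 0) {x : ℂ} :
    c * x ∈ (L.smul hc).lattice ↔ x ∈ L.lattice := by
  simp only [mem_lattice, smul_ω₁, smul_ω₂]
  refine exists_congr fun m ↦ exists_congr fun n ↦ ?_
  rw [← mul_right_inj' hc (b := (m * L.ω₁ + n * L.ω₂ : ℂ))]
  have : m * (c * L.ω₁) + n * (c * L.ω₂) = c * (m * L.ω₁ + n * L.ω₂) := by ring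
  rw [this]

theorem G_eq_of_mem_iff {L L' : PeriodPair} {c : ℂ} (hc : c ≠ 0)
    (h : ∀ x, c * x ∈ L'.lattice ↔ x ∈ L.lattice) (n : ℕ) : L'.G n = (c ^ n)⁻¹ * L.G n := by
  let e : L.lattice ≃ L'.lattice := (Equiv.mulLeft₀ c hc).subtypeEquiv fun x ↦ (h x).symm
  rw [G, G, ← e.tsum_eq, ← tsum_mul_left]
  refine tsum_congr fun l ↦ ?_
  change ((c * (l : ℂ)) ^ n)⁻¹ = _
  rw [mul_pow, mul_inv]

/-- A multiple of the hexagonal lattice has the invariants `g₂ = 0` and `g₃ = 8`. -/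
theorem exists_g₂_eq_zero_and_g₃_eq : ∃ L : PeriodPair, L.g₂ = 0 ∧ L.g₃ = 8 := by
  set ρ : ℂ := ⟨-1 / 2, √3 / 2⟩ with hρ
  have h3 : √3 * √3 = 3 := Real.mul_self_sqrt (by norm_num)
  have hρ2 : ρ * ρ = -1 - ρ := by
    apply Complex.ext <;> simp [hρ] <;> linarith
  have hρ0 : ρ ≠ 0 := by rintro h; rw [h] at hρ2; norm_num at hρ2
  let H : PeriodPair := ⟨1, ρ, by
    rw [LinearIndependent.pair_iff]
    intro s t hst
    have h1 := congrArg Complex.im hst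
    have h2 := congrArg Complex.re hst
    simp [hρ] at h1 h2
    subst h1
    simpa using h2⟩
  -- Multiplication by the cube root of unity `ρ` preserves the lattice: `ρ (m + nρ) = -n + (m -
  -- n)ρ`, and its inverse is multiplication by `ρ²`.
  have hmem : ∀ x, ρ * x ∈ H.lattice ↔ x ∈ H.lattice := by
    have hf : ∀ x ∈ H.lattice, ρ * x ∈ H.lattice := by
      intro x hx
      obtain ⟨m, n, rfl⟩ := mem_lattice.1 hx
      refine mem_lattice.2 ⟨-n, m - n, ?_⟩
      simp only [H]
      push_cast
      linear_combination -n * hρ2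
    intro x
    refine ⟨fun hx ↦ ?_, hf x⟩
    have := hf _ (hf _ hx)
    have h1 : ρ * (ρ * (ρ * x)) = x := by linear_combination (ρ - 1) * x * hρ2
    rwa [h1] at this
  have hG4 : H.G 4 = 0 := by
    -- The symmetry gives `G₄ = ρ⁻⁴ G₄ = ρ⁻¹ G₄` with `ρ ≠ 1`.
    have h := G_eq_of_mem_iff hρ0 hmem 4
    have h1 : ρ ^ 4 = ρ := by linear_combination (ρ ^ 2 - ρ) * hρ2
    rw [h1] at h
    have h2 : (ρ - 1) * H.G 4 = 0 := by
      field_simp at h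
      linear_combination h
    refine (mul_eq_zero.1 h2).resolve_left fun h0 ↦ ?_
    rw [sub_eq_zero.1 h0] at hρ2
    norm_num at hρ2
  have hg2 : H.g₂ = 0 := by rw [g₂, hG4, mul_zero]
  have hg3 : H.g₃ ≠ 0 := H.g₂_ne_zero_or_g₃_ne_zero.resolve_left (not_not.2 hg2)
  -- Scaling the lattice by `c` divides `g₃` by `c⁶`.
  obtain ⟨c, hc⟩ := IsAlgClosed.exists_pow_nat_eq (H.g₃ / 8) (n := 6) (by norm_num)
  have hc0 : c ≠ 0 := by
    rintro rfl
    rw [zero_pow (by norm_num), eq_comm, div_eq_zero_iff] at hc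
    exact hc.elim hg3 (by norm_num)
  refine ⟨H.smul hc0, ?_, ?_⟩
  · rw [g₂, G_eq_of_mem_iff hc0 (fun x ↦ H.mem_lattice_smul hc0), hG4]
    simp
  · rw [g₃, G_eq_of_mem_iff hc0 (fun x ↦ H.mem_lattice_smul hc0), hc]
    have : 140 * H.G 6 ≠ 0 := hg3
    rw [g₃]
    have h6 : H.G 6 ≠ 0 := by rintro h; simp [h] at this
    field_simp

end PeriodPair

/-! ### Maps into the cubic in homogeneous coordinates -/

namespace FermatCubic

theorem mk_eq_mk_iff (v w : Fin 3 → ℂ) (h0 hv h0' hw) :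
    mk v h0 hv = mk w h0' hw ↔ ∃ t : ℂ, t • w = v :=
  ⟨fun h ↦ (Projectivization.mk_eq_mk_iff' ℂ v w h0 h0').1 (congrArg Subtype.val h),
    fun ⟨t, ht⟩ ↦ mk_eq_mk v w h0 hv h0' hw t ht⟩

theorem chart_mem_maximalAtlas (σ s₀ hs) :
    chart σ s₀ hs ∈ IsManifold.maximalAtlas 𝓘(ℂ) ω FermatCubic :=
  IsManifold.subset_maximalAtlas ⟨σ, s₀, hs, rfl⟩

/-- The map `ψ` into the cubic has the homogeneous coordinates `v` near `z₀`. -/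
def HasCoordsAt (ψ : ℂ → FermatCubic) (v : ℂ → Fin 3 → ℂ) (z₀ : ℂ) : Prop :=
  ∀ᶠ z in 𝓝 z₀, ∃ h0 hv, ψ z = mk (v z) h0 hv

theorem ne_zero_of_mem_chart_source {σ s₀ hs v h0 hv} (h : mk v h0 hv ∈ (chart σ s₀ hs).source) :
    v (σ 0) ≠ 0 ∧ v (σ 1) ≠ 0 := by
  have h' : v (σ 1) / v (σ 0) / s₀ ∈ sector := h
  refine ⟨ne_zero_of_div_mem_sector h', fun h1 ↦ ne_zero_of_mem_sector h' ?_⟩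
  simp [h1]

theorem HasCoordsAt.eventually_mem_source {ψ : ℂ → FermatCubic} {v : ℂ → Fin 3 → ℂ} {z₀ : ℂ}
    (h : HasCoordsAt ψ v z₀) (hv : ∀ i, ContinuousAt (fun z ↦ v z i) z₀) {σ s₀ hs}
    (hmem : ψ z₀ ∈ (chart σ s₀ hs).source) :
    ∀ᶠ z in 𝓝 z₀, ψ z ∈ (chart σ s₀ hs).source ∧
      chart σ s₀ hs (ψ z) = v z (σ 2) / v z (σ 0) := by
  obtain ⟨h0, hv0, he⟩ := h.self_of_nhds
  rw [he] at hmem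
  have hne := (ne_zero_of_mem_chart_source hmem).1
  have hc : ContinuousAt (fun z ↦ v z (σ 1) / v z (σ 0) / s₀) z₀ :=
    ((hv _).div (hv _) hne).div_const s₀
  filter_upwards [h, hc.eventually (isOpen_sector.mem_nhds hmem)] with z hz hz'
  obtain ⟨h1, hv1, he1⟩ := hz
  rw [he1]
  exact ⟨hz', rfl⟩

theorem HasCoordsAt.contMDiffAt {ψ : ℂ → FermatCubic} {v : ℂ → Fin 3 → ℂ} {z₀ : ℂ}
    (h : HasCoordsAt ψ v z₀) (hv : ∀ i, AnalyticAt ℂ (fun z ↦ v z i) z₀) :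
    ContMDiffAt 𝓘(ℂ) 𝓘(ℂ) ω ψ z₀ := by
  obtain ⟨σ, s₀, hs, hmem⟩ := exists_mem_chart_source (ψ z₀)
  have hev := h.eventually_mem_source (fun i ↦ (hv i).continuousAt) hmem
  obtain ⟨h0, hv0, he⟩ := h.self_of_nhds
  have hne := (ne_zero_of_mem_chart_source (he ▸ hmem)).1
  have h1 : ContMDiffAt 𝓘(ℂ) 𝓘(ℂ) ω (fun z ↦ v z (σ 2) / v z (σ 0)) z₀ :=
    ((hv _).div (hv _) hne).contDiffAt.contMDiffAt
  have h2 := contMDiffOn_symm_of_mem_maximalAtlas (chart_mem_maximalAtlas σ s₀ hs)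
  have h3 : v z₀ (σ 2) / v z₀ (σ 0) ∈ (chart σ s₀ hs).target := by
    rw [← hev.self_of_nhds.2]
    exact (chart σ s₀ hs).map_source hmem
  refine ((h2.contMDiffAt ((chart σ s₀ hs).open_target.mem_nhds h3)).comp z₀
    h1).congr_of_eventuallyEq ?_
  filter_upwards [hev] with z hz
  rw [Function.comp_apply, ← hz.2, (chart σ s₀ hs).left_inv hz.1]

/-- In a chart the map is a quotient of two coordinates, and `hW` says that the numerator of its
derivative is nonzero, so the inverse function theorem applies. Only coordinates with `v (σ 0)` and
`v (σ 1)` nonzero matter, because only those give charts at the point. -/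
theorem HasCoordsAt.exists_local_section {ψ : ℂ → FermatCubic} {v : ℂ → Fin 3 → ℂ} {z₀ : ℂ}
    (h : HasCoordsAt ψ v z₀) (hv : ∀ i, AnalyticAt ℂ (fun z ↦ v z i) z₀) {v' : Fin 3 → ℂ}
    (hv' : ∀ i, HasDerivAt (fun z ↦ v z i) (v' i) z₀)
    (hW : ∀ σ : Equiv.Perm (Fin 3), v z₀ (σ 0) ≠ 0 → v z₀ (σ 1) ≠ 0 →
      v' (σ 2) * v z₀ (σ 0) - v z₀ (σ 2) * v' (σ 0) ≠ 0) :
    ∃ χ : FermatCubic → ℂ, ContMDiffAt 𝓘(ℂ) 𝓘(ℂ) ω χ (ψ z₀) ∧ ∀ᶠ p in 𝓝 (ψ z₀), ψ (χ p) = p := by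
  obtain ⟨σ, s₀, hs, hmem⟩ := exists_mem_chart_source (ψ z₀)
  have hev := h.eventually_mem_source (fun i ↦ (hv i).continuousAt) hmem
  obtain ⟨h0, hv0, he⟩ := h.self_of_nhds
  obtain ⟨hne, hne1⟩ := ne_zero_of_mem_chart_source (he ▸ hmem)
  set φ : ℂ → ℂ := fun z ↦ v z (σ 2) / v z (σ 0) with hφdef
  have hφ : AnalyticAt ℂ φ z₀ := (hv _).div (hv _) hne
  have hφ' : deriv φ z₀ ≠ 0 := by
    rw [((hv' (σ 2)).fun_div (hv' (σ 0)) hne).deriv]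
    exact div_ne_zero (hW σ hne hne1) (pow_ne_zero 2 hne)
  set r := hφ.hasStrictDerivAt.localInverse _ _ _ hφ' with hr
  have hra : AnalyticAt ℂ r (φ z₀) := hφ.analyticAt_localInverse hφ'
  have hr0 : r (φ z₀) = z₀ := HasStrictFDerivAt.localInverse_apply_image ..
  have hri : ∀ᶠ t in 𝓝 (φ z₀), φ (r t) = t := hφ.hasStrictDerivAt.eventually_right_inverse hφ'
  have hφe : chart σ s₀ hs (ψ z₀) = φ z₀ := hev.self_of_nhds.2
  have hchart := contMDiffAt_of_mem_maximalAtlas (chart_mem_maximalAtlas σ s₀ hs) hmem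
  have hra' : ContMDiffAt 𝓘(ℂ) 𝓘(ℂ) ω r (chart σ s₀ hs (ψ z₀)) := by
    rw [hφe]; exact hra.contDiffAt.contMDiffAt
  have hχ := hra'.comp (ψ z₀) hchart
  refine ⟨r ∘ chart σ s₀ hs, hχ, ?_⟩
  have ht : Tendsto (chart σ s₀ hs) (𝓝 (ψ z₀)) (𝓝 (φ z₀)) := hφe ▸ hchart.continuousAt
  have ht' : Tendsto (r ∘ chart σ s₀ hs) (𝓝 (ψ z₀)) (𝓝 z₀) := by
    have h1 : Tendsto r (𝓝 (φ z₀)) (𝓝 (r (φ z₀))) := hra.continuousAt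
    rw [hr0] at h1
    exact h1.comp ht
  filter_upwards [ht.eventually hri, ht'.eventually hev,
    (chart σ s₀ hs).open_source.mem_nhds hmem] with p hp1 hp2 hp3
  -- Both points lie in the source of one chart and have the same chart value.
  exact (chart σ s₀ hs).injOn hp2.1 hp3 (hp2.2.trans hp1)

end FermatCubic

/-! ### Analytic maps from and to the torus -/

namespace PeriodPair

variable (L : PeriodPair)

theorem contMDiff_mkQ : ContMDiff 𝓘(ℂ) 𝓘(ℂ) ω (L.lattice.mkQ : ℂ → L.Torus) := by
  intro z
  set q : L.Torus := L.lattice.mkQ z with hq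
  have hs := L.exists_eq_of_mem_atlas (chart_mem_atlas ℂ q)
  set l : ℂ := chartAt ℂ q q - z with hl
  have hlm : l ∈ L.lattice := by
    have h1 := (chartAt ℂ q).left_inv (mem_chart_source ℂ q)
    rw [hs] at h1
    exact (Submodule.Quotient.eq L.lattice).1 h1
  have heq : (L.lattice.mkQ : ℂ → L.Torus) = (chartAt ℂ q).symm ∘ fun w ↦ w + l := by
    funext w
    rw [Function.comp_apply, hs, map_add]
    simpa using hlm
  have h1 : ContMDiffAt 𝓘(ℂ) 𝓘(ℂ) ω (fun w : ℂ ↦ w + l) z :=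
    (contDiff_id.add contDiff_const).contMDiff.contMDiffAt
  have h2 : z + l ∈ (chartAt ℂ q).target := by
    rw [hl, add_sub_cancel]
    exact mem_chart_target ℂ q
  have h3 := (contMDiffOn_chart_symm (I := 𝓘(ℂ)) (n := ω) (x := q)).contMDiffAt
    ((chartAt ℂ q).open_target.mem_nhds h2)
  rw [heq]
  exact h3.comp z h1

/-- A map on the torus is analytic if its composition with the projection of `ℂ` is. -/
theorem contMDiff_of_comp_mkQ {Φ : L.Torus → FermatCubic}
    (h : ContMDiff 𝓘(ℂ) 𝓘(ℂ) ω fun z ↦ Φ (L.lattice.mkQ z)) : ContMDiff 𝓘(ℂ) 𝓘(ℂ) ω Φ := by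
  intro q
  have hs := L.exists_eq_of_mem_atlas (chart_mem_atlas ℂ q)
  refine ((h _).comp q (contMDiffAt_of_mem_maximalAtlas (IsManifold.chart_mem_maximalAtlas q)
    (mem_chart_source ℂ q))).congr_of_eventuallyEq ?_
  filter_upwards [(chartAt ℂ q).open_source.mem_nhds (mem_chart_source ℂ q)] with p hp
  rw [Function.comp_apply, ← hs, (chartAt ℂ q).left_inv hp]

/-! ### The parametrization of the cubic and its bijectivity modulo `Λ` -/

/-- The constant `1 / √24`. -/
def invSqrt24 : ℂ := 1 / (√24 : ℝ)

theorem invSqrt24_sq : 24 * invSqrt24 ^ 2 = 1 := by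
  have h : ((√24 : ℝ) : ℂ) ^ 2 = 24 := by
    rw [← Complex.ofReal_pow, Real.sq_sqrt (by norm_num)]; norm_num
  rw [invSqrt24, div_pow, h]
  norm_num

theorem invSqrt24_ne_zero : invSqrt24 ≠ 0 := fun h ↦ by
  have := invSqrt24_sq
  simp [h] at this

/-- The homogeneous coordinates of the image of `z ∉ Λ` on the Fermat cubic. -/
def fermatVec (z : ℂ) : Fin 3 → ℂ :=
  ![1 - invSqrt24 * L.derivWeierstrassP z, 1 + invSqrt24 * L.derivWeierstrassP z,
    L.weierstrassP z]

theorem fermatVec_ne_zero (z : ℂ) : L.fermatVec z ≠ 0 := fun h ↦ by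
  have h0 := congrFun h 0
  have h1 := congrFun h 1
  simp only [fermatVec, Matrix.cons_val_zero, Matrix.cons_val_one, Pi.zero_apply] at h0 h1
  have : (2 : ℂ) = 0 := by linear_combination h0 + h1
  norm_num at this

variable {L}

theorem fermatVec_equation (h₂ : L.g₂ = 0) (h₃ : L.g₃ = 8) {z : ℂ} (hz : z ∉ L.lattice) :
    L.fermatVec z 0 ^ 3 + L.fermatVec z 1 ^ 3 = L.fermatVec z 2 ^ 3 := by
  have h := L.derivWeierstrassP_sq z hz
  rw [h₂, h₃] at h
  simp only [fermatVec, Matrix.cons_val_zero, Matrix.cons_val_one, Matrix.cons_val]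
  linear_combination 6 * invSqrt24 ^ 2 * h + (L.weierstrassP z ^ 3 - 2) * invSqrt24_sq

open Classical in
/-- The map `z ↦ [1 - ℘' / √24 : 1 + ℘' / √24 : ℘]` into the Fermat cubic. -/
def toFermat (h₂ : L.g₂ = 0) (h₃ : L.g₃ = 8) (z : ℂ) : FermatCubic :=
  -- The value at the poles is the limit: `℘'` dominates `1` and `℘`, leaving the direction `(-1, 1,
  -- 0)`.
  if hz : z ∈ L.lattice then
    FermatCubic.mk ![-1, 1, 0] (fun h ↦ one_ne_zero (congrFun h 1)) (by simp; norm_num)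
  else FermatCubic.mk (L.fermatVec z) (L.fermatVec_ne_zero z) (fermatVec_equation h₂ h₃ hz)

variable (h₂ : L.g₂ = 0) (h₃ : L.g₃ = 8)

theorem toFermat_of_mem {z : ℂ} (hz : z ∈ L.lattice) : toFermat h₂ h₃ z =
    FermatCubic.mk ![-1, 1, 0] (fun h ↦ one_ne_zero (congrFun h 1)) (by simp; norm_num) :=
  dif_pos hz

theorem toFermat_of_notMem {z : ℂ} (hz : z ∉ L.lattice) : toFermat h₂ h₃ z =
    FermatCubic.mk (L.fermatVec z) (L.fermatVec_ne_zero z) (fermatVec_equation h₂ h₃ hz) :=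
  dif_neg hz

theorem toFermat_add_of_mem (z : ℂ) {l : ℂ} (hl : l ∈ L.lattice) :
    toFermat h₂ h₃ (z + l) = toFermat h₂ h₃ z := by
  by_cases hz : z ∈ L.lattice
  · rw [toFermat_of_mem h₂ h₃ hz, toFermat_of_mem h₂ h₃ ((L.add_mem_lattice_iff hl).2 hz)]
  · rw [toFermat_of_notMem h₂ h₃ hz,
      toFermat_of_notMem h₂ h₃ (mt (L.add_mem_lattice_iff hl).1 hz)]
    have h1 := L.weierstrassP_add_coe z ⟨l, hl⟩
    have h2 := L.derivWeierstrassP_add_coe z ⟨l, hl⟩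
    simp only at h1 h2
    simp only [fermatVec, h1, h2]

/-- The first two coordinates of `fermatVec` always sum to `2`, and those of `(-1, 1, 0)` to `0`.
Hence lattice points are separated from the rest, and off the lattice the proportionality factor is
`1`. -/
theorem sub_mem_of_toFermat_eq {z w : ℂ} (h : toFermat h₂ h₃ z = toFermat h₂ h₃ w) :
    z - w ∈ L.lattice := by
  have hmixed : ∀ z w : ℂ, z ∈ L.lattice → w ∉ L.lattice →
      toFermat h₂ h₃ z ≠ toFermat h₂ h₃ w := by
    intro z w hz hw h
    rw [toFermat_of_mem h₂ h₃ hz, toFermat_of_notMem h₂ h₃ hw, eq_comm,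
      FermatCubic.mk_eq_mk_iff] at h
    obtain ⟨t, ht⟩ := h
    have h0 := congrFun ht 0
    have h1 := congrFun ht 1
    simp only [fermatVec, Matrix.cons_val_zero, Matrix.cons_val_one, Pi.smul_apply,
      smul_eq_mul] at h0 h1
    have : (2 : ℂ) = 0 := by linear_combination -h0 - h1
    norm_num at this
  by_cases hz : z ∈ L.lattice <;> by_cases hw : w ∈ L.lattice
  · exact sub_mem hz hw
  · exact absurd h (hmixed z w hz hw)
  · exact absurd h.symm (hmixed w z hw hz)
  · rw [toFermat_of_notMem h₂ h₃ hz, toFermat_of_notMem h₂ h₃ hw, FermatCubic.mk_eq_mk_iff] at h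
    obtain ⟨t, ht⟩ := h
    have h0 := congrFun ht 0
    have h1 := congrFun ht 1
    have h2 := congrFun ht 2
    simp only [fermatVec, Matrix.cons_val_zero, Matrix.cons_val_one, Pi.smul_apply,
      smul_eq_mul, Matrix.cons_val] at h0 h1 h2
    have ht1 : t = 1 := by linear_combination (h0 + h1) / 2
    subst ht1
    refine L.sub_mem_lattice_of_eq hz hw (by linear_combination -h2)
      (mul_left_cancel₀ invSqrt24_ne_zero ?_)
    linear_combination -h1

theorem toFermat_surjective : Function.Surjective (toFermat h₂ h₃) := by
  intro p
  obtain ⟨v, h0, hv, rfl⟩ := FermatCubic.exists_mk p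
  by_cases hs : v 0 + v 1 = 0
  · have h10 : v 0 = -v 1 := eq_neg_of_add_eq_zero_left hs
    have h20 : v 2 = 0 := by
      rw [h10] at hv
      have : v 2 ^ 3 = 0 := by linear_combination -hv
      simpa using this
    refine ⟨0, ?_⟩
    rw [toFermat_of_mem h₂ h₃ (zero_mem _), eq_comm, FermatCubic.mk_eq_mk_iff]
    refine ⟨v 1, ?_⟩
    funext i
    fin_cases i <;> simp [h10, h20]
  -- The factor `t` normalizes the first two coordinates to sum `2`. Their difference is then `2℘' /
  -- √24`, whence the prescribed value of `℘'`, as `√24 / 2 = 12 / √24`.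
  · set t : ℂ := 2 / (v 0 + v 1) with ht
    have hts : t * (v 0 + v 1) = 2 := by rw [ht]; field_simp
    obtain ⟨z, hz, hP, hQ⟩ := L.exists_weierstrassP_eq_and_derivWeierstrassP_eq
      (p := t * v 2) (q := 12 * invSqrt24 * t * (v 1 - v 0)) (by
        rw [h₂, h₃]
        linear_combination (4 * t ^ 3) * hv + 6 * t ^ 2 * (v 1 - v 0) ^ 2 * invSqrt24_sq
          - (3 * t ^ 2 * (v 1 - v 0) ^ 2 + (t * (v 0 + v 1)) ^ 2
            + 2 * (t * (v 0 + v 1)) + 4) * hts)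
    refine ⟨z, ?_⟩
    rw [toFermat_of_notMem h₂ h₃ hz, FermatCubic.mk_eq_mk_iff]
    refine ⟨t, ?_⟩
    funext i
    fin_cases i
    · simp only [fermatVec, hQ, Pi.smul_apply, smul_eq_mul, Fin.zero_eta, Matrix.cons_val_zero]
      linear_combination hts / 2 + t * (v 1 - v 0) / 2 * invSqrt24_sq
    · simp only [fermatVec, hQ, Pi.smul_apply, smul_eq_mul, Fin.mk_one, Matrix.cons_val_one,
        Matrix.cons_val_zero]
      linear_combination hts / 2 - t * (v 1 - v 0) / 2 * invSqrt24_sq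
    · simp only [fermatVec, hP, Pi.smul_apply, smul_eq_mul, Fin.reduceFinMk, Matrix.cons_val]

theorem hasCoordsAt_toFermat_of_notMem {z : ℂ} (hz : z ∉ L.lattice) :
    FermatCubic.HasCoordsAt (toFermat h₂ h₃) L.fermatVec z := by
  filter_upwards [L.isOpen_compl_lattice.mem_nhds hz] with w hw
  exact ⟨_, _, toFermat_of_notMem h₂ h₃ hw⟩

variable (L) in
/-- Homogeneous coordinates on the Fermat cubic that are holomorphic near the lattice point `l`. -/
def fermatVecAt (l z : ℂ) : Fin 3 → ℂ :=
  ![(z - l) ^ 3 - invSqrt24 * ((z - l) ^ 3 * L.derivWeierstrassPExcept l z - 2),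
    (z - l) ^ 3 + invSqrt24 * ((z - l) ^ 3 * L.derivWeierstrassPExcept l z - 2),
    -- The summand of `℘` left out at `l` is `1 / (z - l)² - 1 / l²`, so its constant has to be
    -- restored. The cube of `z - l` clears the triple pole of `℘'`.
    (z - l) * (1 + (z - l) ^ 2 * (L.weierstrassPExcept l z - 1 / l ^ 2))]

theorem fermatVecAt_eq {l z : ℂ} (hl : l ∈ L.lattice) (hz : z ≠ l) :
    L.fermatVecAt l z = (z - l) ^ 3 • L.fermatVec z := by
  have hzl : z - l ≠ 0 := sub_ne_zero.2 hz
  have h1 := L.weierstrassPExcept_def ⟨l, hl⟩ z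
  have h2 := L.derivWeierstrassPExcept_def ⟨l, hl⟩ z
  simp only at h1 h2
  have h3 : (z - l) ^ 3 * L.derivWeierstrassPExcept l z - 2 =
      (z - l) ^ 3 * L.derivWeierstrassP z := by
    rw [h2]; field_simp; ring
  have h4 : (z - l) * (1 + (z - l) ^ 2 * (L.weierstrassPExcept l z - 1 / l ^ 2)) =
      (z - l) ^ 3 * L.weierstrassP z := by
    rw [h1]
    linear_combination (-(z - l) ) * (mul_inv_cancel₀ (pow_ne_zero 2 hzl))
  funext i
  fin_cases i
  · simp only [fermatVecAt, fermatVec, h3, Pi.smul_apply, smul_eq_mul, Fin.zero_eta,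
      Matrix.cons_val_zero]
    ring
  · simp only [fermatVecAt, fermatVec, h3, Pi.smul_apply, smul_eq_mul, Fin.mk_one,
      Matrix.cons_val_one, Matrix.cons_val_zero]
    ring
  · simp only [fermatVecAt, fermatVec, h4, Pi.smul_apply, smul_eq_mul, Fin.reduceFinMk,
      Matrix.cons_val]

theorem hasCoordsAt_toFermat_of_mem {l : ℂ} (hl : l ∈ L.lattice) :
    FermatCubic.HasCoordsAt (toFermat h₂ h₃) (L.fermatVecAt l) l := by
  filter_upwards [L.compl_lattice_sdiff_singleton_mem_nhds l] with z hz
  by_cases hzl : z = l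
  · subst hzl
    have hv : L.fermatVecAt z z = (-2 * invSqrt24) • ![-1, 1, 0] := by
      funext i
      fin_cases i <;> simp [fermatVecAt] <;> ring
    have hne : -2 * invSqrt24 ≠ 0 := mul_ne_zero (by norm_num) invSqrt24_ne_zero
    have h0 : L.fermatVecAt z z ≠ 0 := by
      rw [hv]
      exact smul_ne_zero hne fun h ↦ one_ne_zero (congrFun h 1)
    refine ⟨h0, by rw [hv]; simp; ring, ?_⟩
    rw [toFermat_of_mem h₂ h₃ hl, eq_comm, FermatCubic.mk_eq_mk_iff]
    exact ⟨_, hv.symm⟩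
  · have hz' : z ∉ L.lattice := by simp_all
    have hv := fermatVecAt_eq hl hzl
    have hne : (z - l) ^ 3 ≠ 0 := pow_ne_zero 3 (sub_ne_zero.2 hzl)
    refine ⟨by rw [hv]; exact smul_ne_zero hne (L.fermatVec_ne_zero z), ?_, ?_⟩
    · rw [hv]
      simp only [Pi.smul_apply, smul_eq_mul]
      linear_combination ((z - l) ^ 3) ^ 3 * fermatVec_equation h₂ h₃ hz'
    · rw [toFermat_of_notMem h₂ h₃ hz', eq_comm, FermatCubic.mk_eq_mk_iff]
      exact ⟨_, hv.symm⟩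

theorem analyticAt_fermatVec {z : ℂ} (hz : z ∉ L.lattice) (i : Fin 3) :
    AnalyticAt ℂ (fun w ↦ L.fermatVec w i) z := by
  have h1 := L.analyticAt_weierstrassP hz
  have h2 := L.analyticAt_derivWeierstrassP hz
  fin_cases i <;> simp only [fermatVec, Fin.zero_eta, Fin.mk_one, Fin.reduceFinMk,
    Matrix.cons_val_zero, Matrix.cons_val_one, Matrix.cons_val] <;> fun_prop

theorem analyticAt_fermatVecAt (l : ℂ) (i : Fin 3) :
    AnalyticAt ℂ (fun w ↦ L.fermatVecAt l w i) l := by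
  have h1 := L.analyticAt_weierstrassPExcept l
  have h2 := L.analyticAt_derivWeierstrassPExcept l
  fin_cases i <;> simp only [fermatVecAt, Fin.zero_eta, Fin.mk_one, Fin.reduceFinMk,
    Matrix.cons_val_zero, Matrix.cons_val_one, Matrix.cons_val] <;> fun_prop

theorem contMDiff_toFermat : ContMDiff 𝓘(ℂ) 𝓘(ℂ) ω (toFermat h₂ h₃) := by
  intro z
  by_cases hz : z ∈ L.lattice
  · exact (hasCoordsAt_toFermat_of_mem h₂ h₃ hz).contMDiffAt (analyticAt_fermatVecAt z)
  · exact (hasCoordsAt_toFermat_of_notMem h₂ h₃ hz).contMDiffAt (analyticAt_fermatVec hz)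

/-! ### Local inverses and the biholomorphism -/

theorem perm_fin_three (σ : Equiv.Perm (Fin 3)) :
    (σ 0 = 0 ∧ σ 1 = 1 ∧ σ 2 = 2) ∨ (σ 0 = 0 ∧ σ 1 = 2 ∧ σ 2 = 1) ∨
    (σ 0 = 1 ∧ σ 1 = 0 ∧ σ 2 = 2) ∨ (σ 0 = 1 ∧ σ 1 = 2 ∧ σ 2 = 0) ∨
    (σ 0 = 2 ∧ σ 1 = 0 ∧ σ 2 = 1) ∨ (σ 0 = 2 ∧ σ 1 = 1 ∧ σ 2 = 0) := by
  revert σ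
  decide

/-- The map into the Fermat cubic has holomorphic local sections. -/
theorem exists_local_section_toFermat (z : ℂ) :
    ∃ χ : FermatCubic → ℂ, ContMDiffAt 𝓘(ℂ) 𝓘(ℂ) ω χ (toFermat h₂ h₃ z) ∧
      ∀ᶠ p in 𝓝 (toFermat h₂ h₃ z), toFermat h₂ h₃ (χ p) = p := by
  have hc := invSqrt24_sq
  have hc0 := invSqrt24_ne_zero
  by_cases hz : z ∈ L.lattice
  · have hd : ∀ i, HasDerivAt (fun w ↦ L.fermatVecAt z w i)
        ((![0, 0, 1] : Fin 3 → ℂ) i) z := by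
      have h0 : HasDerivAt (fun w ↦ w - z) 1 z := (hasDerivAt_id z).sub_const z
      have h1 : HasDerivAt (fun w ↦ (w - z) ^ 3) 0 z := by simpa using h0.fun_pow 3
      have h2 := h1.mul (L.analyticAt_derivWeierstrassPExcept z).differentiableAt.hasDerivAt
      have h3 : HasDerivAt (fun w ↦ (w - z) ^ 2) 0 z := by simpa using h0.fun_pow 2
      have h4 := h3.mul ((L.analyticAt_weierstrassPExcept z).differentiableAt.hasDerivAt.sub_const
        (1 / z ^ 2))
      have h5 := h0.mul (h4.const_add 1)
      have h6 := (h2.sub_const 2).const_mul invSqrt24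
      intro i
      fin_cases i
      · simpa [fermatVecAt] using! h1.sub h6
      · simpa [fermatVecAt] using! h1.add h6
      · simpa [fermatVecAt] using! h5
    refine (hasCoordsAt_toFermat_of_mem h₂ h₃ hz).exists_local_section
      (analyticAt_fermatVecAt z) hd fun σ ↦ ?_
    -- As the third coordinate vanishes, only `σ 2 = 2` is relevant, and there the derivative `(0,
    -- 0, 1)` gives a nonzero Wronskian.
    have hv : L.fermatVecAt z z = ![2 * invSqrt24, -2 * invSqrt24, 0] := by
      funext i
      fin_cases i <;> simp [fermatVecAt] <;> ring
    rw [hv]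
    rcases perm_fin_three σ with ⟨h0, h1, h2⟩ | ⟨h0, h1, h2⟩ | ⟨h0, h1, h2⟩ | ⟨h0, h1, h2⟩ |
      ⟨h0, h1, h2⟩ | ⟨h0, h1, h2⟩ <;> simp [h0, h1, h2, hc0]
  · have hP := L.hasDerivAt_weierstrassP hz
    have hQ := L.hasDerivAt_derivWeierstrassP hz
    rw [h₂, zero_div, sub_zero] at hQ
    have hsq := L.derivWeierstrassP_sq z hz
    rw [h₂, h₃] at hsq
    have hd : ∀ i, HasDerivAt (fun w ↦ L.fermatVec w i)
        ((![-(invSqrt24 * (6 * L.weierstrassP z ^ 2)), invSqrt24 * (6 * L.weierstrassP z ^ 2),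
          L.derivWeierstrassP z] : Fin 3 → ℂ) i) z := by
      intro i
      fin_cases i
      · exact (hQ.const_mul invSqrt24).const_sub 1
      · exact (hQ.const_mul invSqrt24).const_add 1
      · exact hP
    refine (hasCoordsAt_toFermat_of_notMem h₂ h₃ hz).exists_local_section
      (analyticAt_fermatVec hz) hd fun σ hσ0 hσ1 ↦ ?_
    set v := L.fermatVec z with hv
    set v' : Fin 3 → ℂ := ![-(invSqrt24 * (6 * L.weierstrassP z ^ 2)),
      invSqrt24 * (6 * L.weierstrassP z ^ 2), L.derivWeierstrassP z] with hv'
    -- The three Wronskians form `v × v'`, the tangent line of the curve, hence are proportional to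
    -- the gradient `(v₀², v₁², -v₂²)` of the cubic. The one for `σ` is thus nonzero exactly when `v
    -- (σ 1)` is.
    have W01 : v' 1 * v 0 - v 1 * v' 0 = 12 * invSqrt24 * v 2 ^ 2 := by
      simp only [hv, hv', fermatVec, Matrix.cons_val_zero, Matrix.cons_val_one, Matrix.cons_val]
      ring
    have W02 : v' 2 * v 0 - v 2 * v' 0 = 12 * invSqrt24 * v 1 ^ 2 := by
      simp only [hv, hv', fermatVec, Matrix.cons_val_zero, Matrix.cons_val_one, Matrix.cons_val]
      linear_combination -(L.derivWeierstrassP z + invSqrt24 * L.derivWeierstrassP z ^ 2 / 2) * hc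
        - 3 / 2 * invSqrt24 * hsq
    have W12 : v' 2 * v 1 - v 2 * v' 1 = -12 * invSqrt24 * v 0 ^ 2 := by
      simp only [hv, hv', fermatVec, Matrix.cons_val_zero, Matrix.cons_val_one, Matrix.cons_val]
      linear_combination -(L.derivWeierstrassP z - invSqrt24 * L.derivWeierstrassP z ^ 2 / 2) * hc
        + 3 / 2 * invSqrt24 * hsq
    have key : v' (σ 2) * v (σ 0) - v (σ 2) * v' (σ 0) = 12 * invSqrt24 * v (σ 1) ^ 2 ∨
        v' (σ 2) * v (σ 0) - v (σ 2) * v' (σ 0) = -12 * invSqrt24 * v (σ 1) ^ 2 := by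
      rcases perm_fin_three σ with ⟨h0, h1, h2⟩ | ⟨h0, h1, h2⟩ | ⟨h0, h1, h2⟩ | ⟨h0, h1, h2⟩ |
        ⟨h0, h1, h2⟩ | ⟨h0, h1, h2⟩ <;> rw [h0, h1, h2]
      · exact .inl W02
      · exact .inl W01
      · exact .inr W12
      · right; linear_combination -W01
      · left; linear_combination -W12
      · right; linear_combination -W02
    rcases key with h | h <;> rw [h] <;>
      exact mul_ne_zero (mul_ne_zero (by norm_num) hc0) (pow_ne_zero 2 hσ1)

/-- The biholomorphism of the torus with the Fermat cubic. -/
theorem exists_diffeomorph : ∃ Φ : Diffeomorph 𝓘(ℂ) 𝓘(ℂ) L.Torus FermatCubic ω,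
    ∀ z, Φ (L.lattice.mkQ z) = toFermat h₂ h₃ z := by
  let Φ : L.Torus → FermatCubic := Quotient.lift (toFermat h₂ h₃) (by
    intro z w h
    have h1 : z - w ∈ L.lattice := (Submodule.quotientRel_def _).1 h
    have h2 := toFermat_add_of_mem h₂ h₃ w h1
    rwa [add_sub_cancel] at h2)
  have hΦ : ∀ z, Φ (L.lattice.mkQ z) = toFermat h₂ h₃ z := fun _ ↦ rfl
  have hbij : Function.Bijective Φ := by
    constructor
    · intro p q h
      obtain ⟨z, rfl⟩ := L.lattice.mkQ_surjective p
      obtain ⟨w, rfl⟩ := L.lattice.mkQ_surjective q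
      exact (Submodule.Quotient.eq _).2 (sub_mem_of_toFermat_eq h₂ h₃ h)
    · intro p
      obtain ⟨z, rfl⟩ := toFermat_surjective h₂ h₃ p
      exact ⟨L.lattice.mkQ z, rfl⟩
  refine ⟨{ toEquiv := Equiv.ofBijective Φ hbij
            contMDiff_toFun := L.contMDiff_of_comp_mkQ (contMDiff_toFermat h₂ h₃)
            contMDiff_invFun := ?_ }, hΦ⟩
  intro p
  obtain ⟨z, rfl⟩ := toFermat_surjective h₂ h₃ p
  obtain ⟨χ, hχ, hev⟩ := exists_local_section_toFermat h₂ h₃ z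
  -- Near `p` the inverse is a local section followed by the projection.
  refine ((L.contMDiff_mkQ _).comp _ hχ).congr_of_eventuallyEq ?_
  filter_upwards [hev] with p hp
  rw [Equiv.symm_apply_eq]
  exact hp.symm

end PeriodPair

/-! ### Meromorphic solutions as holomorphic maps into the cubic -/

theorem eventually_codiscrete_iff {p : ℂ → Prop} :
    (∀ᶠ z in codiscrete ℂ, p z) ↔ ∀ z, ∀ᶠ w in 𝓝[≠] z, p w := by
  change {z | p z} ∈ codiscrete ℂ ↔ _
  rw [mem_codiscrete]
  exact forall_congr' fun z ↦ disjoint_principal_right.trans (by rw [compl_compl]; rfl)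

/-- Analytic homogeneous coordinates without a common zero, from such coordinates with the
third one a power of `z - z₀`. -/
theorem exists_analytic_ne_zero_of_pow {z₀ : ℂ} (n : ℕ) {A B : ℂ → ℂ} (hA : AnalyticAt ℂ A z₀)
    (hB : AnalyticAt ℂ B z₀) : ∃ v : ℂ → Fin 3 → ℂ, (∀ i, AnalyticAt ℂ (fun z ↦ v z i) z₀) ∧
      v z₀ ≠ 0 ∧ ∀ᶠ z in 𝓝[≠] z₀, ∃ t : ℂ, t • v z = ![A z, B z, (z - z₀) ^ n] := by
  have hself : ∀ (m : ℕ) {A B : ℂ → ℂ}, AnalyticAt ℂ A z₀ → AnalyticAt ℂ B z₀ →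
      (A z₀ ≠ 0 ∨ B z₀ ≠ 0 ∨ m = 0) → ∃ v : ℂ → Fin 3 → ℂ,
      (∀ i, AnalyticAt ℂ (fun z ↦ v z i) z₀) ∧
      v z₀ ≠ 0 ∧ ∀ᶠ z in 𝓝[≠] z₀, ∃ t : ℂ, t • v z = ![A z, B z, (z - z₀) ^ m] := by
    intro m A B hA hB hm
    refine ⟨fun z ↦ ![A z, B z, (z - z₀) ^ m], fun i ↦ ?_, fun h ↦ ?_, .of_forall fun z ↦
      ⟨1, one_smul _ _⟩⟩
    · fin_cases i
      · exact hA
      · exact hB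
      · change AnalyticAt ℂ (fun z ↦ (z - z₀) ^ m) z₀
        fun_prop
    · rcases hm with hm | hm | rfl
      · exact hm (congrFun h 0)
      · exact hm (congrFun h 1)
      · exact one_ne_zero ((pow_zero (z₀ - z₀)).symm.trans (congrFun h 2))
  have hdiv : ∀ {C : ℂ → ℂ}, AnalyticAt ℂ C z₀ → C z₀ = 0 →
      ∃ D, AnalyticAt ℂ D z₀ ∧ ∀ᶠ z in 𝓝 z₀, C z = (z - z₀) * D z := by
    intro C hC h0
    have h1 : 1 ≤ analyticOrderAt C z₀ :=
      Order.one_le_iff_ne_zero.2 (hC.analyticOrderAt_ne_zero.2 h0)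
    simpa using (natCast_le_analyticOrderAt hC (n := 1)).1 (by simpa using h1)
  -- A common factor `z - z₀` is divided out until some coordinate is nonzero at `z₀`; the exponent
  -- of the third coordinate bounds the number of divisions.
  induction n generalizing A B with
  | zero => exact hself 0 hA hB (.inr (.inr rfl))
  | succ n ih =>
    by_cases hz : A z₀ ≠ 0 ∨ B z₀ ≠ 0
    · exact hself _ hA hB (hz.elim .inl fun h ↦ .inr (.inl h))
    push Not at hz
    obtain ⟨A', hA', hAe⟩ := hdiv hA hz.1
    obtain ⟨B', hB', hBe⟩ := hdiv hB hz.2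
    obtain ⟨v, hv, hv0, hve⟩ := ih hA' hB'
    refine ⟨v, hv, hv0, ?_⟩
    filter_upwards [hve, mem_nhdsWithin_of_mem_nhds hAe, mem_nhdsWithin_of_mem_nhds hBe]
      with z ⟨t, ht⟩ hzA hzB
    refine ⟨(z - z₀) * t, ?_⟩
    rw [mul_smul, ht]
    funext i
    fin_cases i
    · exact hzA.symm
    · exact hzB.symm
    · exact (pow_succ' _ _).symm

/-- A pair of meromorphic functions has analytic homogeneous coordinates without a common zero. -/
theorem MeromorphicAt.exists_analytic_coords {F G : ℂ → ℂ} {z₀ : ℂ} (hF : MeromorphicAt F z₀)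
    (hG : MeromorphicAt G z₀) : ∃ v : ℂ → Fin 3 → ℂ, (∀ i, AnalyticAt ℂ (fun z ↦ v z i) z₀) ∧
      v z₀ ≠ 0 ∧ ∀ᶠ z in 𝓝[≠] z₀, ∃ t : ℂ, t ≠ 0 ∧ v z = t • ![F z, G z, 1] := by
  obtain ⟨m, hm⟩ := hF
  obtain ⟨n, hn⟩ := hG
  have hA : AnalyticAt ℂ (fun z ↦ (z - z₀) ^ (m + n) * F z) z₀ := by
    have : AnalyticAt ℂ (fun z ↦ (z - z₀) ^ n * ((z - z₀) ^ m • F z)) z₀ := by fun_prop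
    exact this.congr (.of_forall fun z ↦ by simp only [smul_eq_mul]; ring)
  have hB : AnalyticAt ℂ (fun z ↦ (z - z₀) ^ (m + n) * G z) z₀ := by
    have : AnalyticAt ℂ (fun z ↦ (z - z₀) ^ m * ((z - z₀) ^ n • G z)) z₀ := by fun_prop
    exact this.congr (.of_forall fun z ↦ by simp only [smul_eq_mul]; ring)
  obtain ⟨v, hv, hv0, hve⟩ := exists_analytic_ne_zero_of_pow (m + n) hA hB
  refine ⟨v, hv, hv0, ?_⟩
  filter_upwards [hve, self_mem_nhdsWithin] with z ⟨t, ht⟩ hz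
  have hne : (z - z₀) ^ (m + n) ≠ 0 := pow_ne_zero _ (sub_ne_zero.2 hz)
  have hs : t • v z = (z - z₀) ^ (m + n) • ![F z, G z, 1] := by
    rw [ht]
    funext i
    fin_cases i <;> simp
  have ht0 : t ≠ 0 := by
    rintro rfl
    have := congrFun ht 2
    simp only [zero_smul, Pi.zero_apply, Matrix.cons_val] at this
    exact hne this.symm
  refine ⟨t⁻¹ * (z - z₀) ^ (m + n), mul_ne_zero (inv_ne_zero ht0) hne, ?_⟩
  rw [mul_smul, ← hs, smul_smul, inv_mul_cancel₀ ht0, one_smul]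

theorem exists_smul_eq_of_cross_eq_zero {v w : Fin 3 → ℂ} (hw : w ≠ 0)
    (h : ∀ i j, v i * w j - v j * w i = 0) : ∃ t : ℂ, t • w = v := by
  obtain ⟨k, hk⟩ := Function.ne_iff.1 hw
  refine ⟨v k / w k, funext fun i ↦ ?_⟩
  have hk' : w k ≠ 0 := hk
  simp only [Pi.smul_apply, smul_eq_mul]
  field_simp
  linear_combination h k i

namespace FermatCubic

/-- Meromorphic functions with `F³ + G³ = 1` give a holomorphic map into the Fermat cubic. -/
theorem exists_contMDiff_of_meromorphic {F G : ℂ → ℂ} (hF : Meromorphic F) (hG : Meromorphic G)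
    (h : ∀ᶠ z in codiscrete ℂ, F z ^ 3 + G z ^ 3 = 1) :
    ∃ f : ℂ → FermatCubic, ContMDiff 𝓘(ℂ) 𝓘(ℂ) ω f ∧
      ∀ᶠ z in codiscrete ℂ, ∃ h0 hv, f z = mk ![F z, G z, 1] h0 hv := by
  rw [eventually_codiscrete_iff] at h
  choose v hv hv0 hve using fun z₀ ↦ (hF z₀).exists_analytic_coords (hG z₀)
  have hpunct : ∀ z₀, ∀ᶠ z in 𝓝[≠] z₀, v z₀ z 0 ^ 3 + v z₀ z 1 ^ 3 = v z₀ z 2 ^ 3 := by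
    intro z₀
    filter_upwards [hve z₀, h z₀] with z ⟨t, ht, he⟩ hz
    rw [he]
    simp only [Pi.smul_apply, smul_eq_mul, Matrix.cons_val_zero, Matrix.cons_val_one,
      Matrix.cons_val]
    linear_combination t ^ 3 * hz
  have heq : ∀ z₀, v z₀ z₀ 0 ^ 3 + v z₀ z₀ 1 ^ 3 = v z₀ z₀ 2 ^ 3 := by
    intro z₀
    have hc := fun i ↦ (hv z₀ i).continuousAt
    have h1 : Tendsto (fun z ↦ v z₀ z 0 ^ 3 + v z₀ z 1 ^ 3) (𝓝[≠] z₀)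
        (𝓝 (v z₀ z₀ 0 ^ 3 + v z₀ z₀ 1 ^ 3)) :=
      (((hc 0).pow 3).add ((hc 1).pow 3)).tendsto.mono_left nhdsWithin_le_nhds
    have h2 : Tendsto (fun z ↦ v z₀ z 2 ^ 3) (𝓝[≠] z₀) (𝓝 (v z₀ z₀ 2 ^ 3)) :=
      ((hc 2).pow 3).tendsto.mono_left nhdsWithin_le_nhds
    exact tendsto_nhds_unique_of_eventuallyEq h1 h2 (hpunct z₀)
  -- The vectors chosen at `z` and at `z₀` are both multiples of `(F, G, 1)` in a punctured
  -- neighbourhood of `z`, so their minors vanish there and, by continuity, at `z`. Hence the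
  -- pointwise choice of coordinates in `f` agrees locally with one analytic family.
  have hcross : ∀ z₀, ∀ᶠ z in 𝓝[≠] z₀, ∀ i j, v z z i * v z₀ z j - v z z j * v z₀ z i = 0 := by
    intro z₀
    have h1 : ∀ᶠ z in 𝓝[≠] z₀, ∀ᶠ w in 𝓝 z, ∃ t : ℂ, t ≠ 0 ∧ v z₀ w = t • ![F w, G w, 1] := by
      filter_upwards [eventually_eventually_nhdsWithin.2 (hve z₀), self_mem_nhdsWithin] with z hz hne
      rwa [isOpen_compl_singleton.nhdsWithin_eq hne] at hz
    have h2 : ∀ᶠ z in 𝓝[≠] z₀, ∀ i, AnalyticAt ℂ (fun z ↦ v z₀ z i) z :=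
      eventually_nhdsWithin_of_eventually_nhds
        (eventually_all.2 fun i ↦ (hv z₀ i).eventually_analyticAt)
    filter_upwards [h1, h2] with z hz1 hz2 i j
    have hc : ContinuousAt (fun w ↦ v z w i * v z₀ w j - v z w j * v z₀ w i) z :=
      (((hv z i).mul (hz2 j)).sub ((hv z j).mul (hz2 i))).continuousAt
    refine tendsto_nhds_unique_of_eventuallyEq (hc.tendsto.mono_left nhdsWithin_le_nhds)
      (tendsto_const_nhds (x := (0 : ℂ)) (f := 𝓝[≠] z)) ?_
    filter_upwards [hve z, mem_nhdsWithin_of_mem_nhds hz1] with w ⟨t, _, ht⟩ ⟨s, _, hs⟩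
    rw [ht, hs]
    simp only [Pi.smul_apply, smul_eq_mul]
    ring
  let f : ℂ → FermatCubic := fun z ↦ mk (v z z) (hv0 z) (heq z)
  have hcoords : ∀ z₀, HasCoordsAt f (v z₀) z₀ := by
    intro z₀
    filter_upwards [eventually_nhdsWithin_iff.1 ((hcross z₀).and ((hpunct z₀).and (hve z₀)))]
      with z hz
    by_cases hzz : z = z₀
    · subst hzz
      exact ⟨hv0 z, heq z, rfl⟩
    obtain ⟨hz1, hz2, t, ht, hz3⟩ := hz hzz
    have hne : v z₀ z ≠ 0 := by
      rw [hz3]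
      exact smul_ne_zero ht fun h ↦ one_ne_zero (congrFun h 2)
    exact ⟨hne, hz2, (mk_eq_mk_iff _ _ _ _ _ _).2 (exists_smul_eq_of_cross_eq_zero hne hz1)⟩
  refine ⟨f, fun z₀ ↦ (hcoords z₀).contMDiffAt (hv z₀), eventually_codiscrete_iff.2 fun z₀ ↦ ?_⟩
  filter_upwards [mem_nhdsWithin_of_mem_nhds (hcoords z₀), hve z₀, h z₀]
    with z ⟨h0, h1, hz1⟩ ⟨t, ht, hz2⟩ hz3
  refine ⟨fun h ↦ one_ne_zero (congrFun h 2), by simpa using hz3, ?_⟩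
  rw [hz1, mk_eq_mk_iff]
  exact ⟨t, hz2.symm⟩

end FermatCubic

/-! ### Lifting to the plane -/

namespace PeriodPair

variable (L : PeriodPair)

theorem isCoveringMap_mkQ : IsCoveringMap (L.lattice.mkQ : ℂ → L.Torus) :=
  (L.lattice.toAddSubgroup.isAddQuotientCoveringMap_of_comm
    ⟨inferInstanceAs (DiscreteTopology L.lattice)⟩).isCoveringMap

/-- A continuous lift of a holomorphic map into the torus is holomorphic. -/
theorem differentiable_of_contMDiff_mkQ {α : ℂ → ℂ} (hα : Continuous α)
    (h : ContMDiff 𝓘(ℂ) 𝓘(ℂ) ω fun z ↦ (L.lattice.mkQ (α z) : L.Torus)) :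
    Differentiable ℂ α := by
  intro z₀
  set q : L.Torus := L.lattice.mkQ (α z₀) with hq
  set e := chartAt ℂ q with he
  have hs := L.exists_eq_of_mem_atlas (chart_mem_atlas ℂ q)
  set l : ℂ := e q - α z₀ with hl
  have hlm : l ∈ L.lattice := by
    have h1 := e.left_inv (mem_chart_source ℂ q)
    rw [hs] at h1
    exact (Submodule.Quotient.eq L.lattice).1 h1
  -- Continuity keeps `α z + l` in the target of one chart, so the same period `l` serves for all
  -- nearby `z`.
  have hev : ∀ᶠ z in 𝓝 z₀, α z + l ∈ e.target := by
    refine (hα.add continuous_const).continuousAt.eventually (e.open_target.mem_nhds ?_)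
    change α z₀ + l ∈ e.target
    rw [hl, add_sub_cancel]
    exact mem_chart_target ℂ q
  have h1 : ContMDiffAt 𝓘(ℂ) 𝓘(ℂ) ω (fun z ↦ e (L.lattice.mkQ (α z))) z₀ :=
    (contMDiffAt_of_mem_maximalAtlas (IsManifold.chart_mem_maximalAtlas q)
      (mem_chart_source ℂ q)).comp z₀ (h z₀)
  have h2 := (contMDiffAt_iff_contDiffAt.1 h1).differentiableAt (by simp)
  refine (h2.sub_const l).congr_of_eventuallyEq ?_
  filter_upwards [hev] with z hz
  have h3 := e.right_inv hz
  rw [hs, map_add] at h3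
  have h4 : L.lattice.mkQ l = 0 := by simpa using hlm
  rw [h4, add_zero] at h3
  rw [h3, add_sub_cancel_right]

/-- A holomorphic map of the plane into the torus lifts to an entire function. -/
theorem exists_differentiable_lift {f : ℂ → L.Torus} (hf : ContMDiff 𝓘(ℂ) 𝓘(ℂ) ω f) :
    ∃ α : ℂ → ℂ, Differentiable ℂ α ∧ ∀ z, L.lattice.mkQ (α z) = f z := by
  obtain ⟨w, hw⟩ := L.lattice.mkQ_surjective (f 0)
  obtain ⟨α, ⟨-, hα⟩, -⟩ := L.isCoveringMap_mkQ.existsUnique_continuousMap_lifts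
    ⟨f, hf.continuous⟩ 0 w hw
  have hα' : ∀ z, L.lattice.mkQ (α z) = f z := congrFun hα
  refine ⟨α, L.differentiable_of_contMDiff_mkQ α.continuous ?_, hα'⟩
  simpa only [hα'] using hf

variable {L}

/-- Lattice points and zeros of `℘` go to the line at infinity, so an affine image excludes both.
The proportionality factor is then read off the third coordinate as `℘ z`. -/
theorem weierstrassP_ne_zero_and_eq_of_toFermat_eq_mk (h₂ : L.g₂ = 0) (h₃ : L.g₃ = 8)
    {z x y : ℂ} {h0 hv} (h : toFermat h₂ h₃ z = FermatCubic.mk ![x, y, 1] h0 hv) :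
    z ∉ L.lattice ∧ L.weierstrassP z ≠ 0 ∧
      x = 1 / L.weierstrassP z * (1 - invSqrt24 * L.derivWeierstrassP z) ∧
      y = 1 / L.weierstrassP z * (1 + invSqrt24 * L.derivWeierstrassP z) := by
  by_cases hz : z ∈ L.lattice
  · rw [toFermat_of_mem h₂ h₃ hz, FermatCubic.mk_eq_mk_iff] at h
    obtain ⟨t, ht⟩ := h
    have ht0 : t = 0 := by simpa using congrFun ht 2
    simpa [ht0] using congrFun ht 1
  rw [toFermat_of_notMem h₂ h₃ hz, FermatCubic.mk_eq_mk_iff] at h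
  obtain ⟨t, ht⟩ := h
  have e0 := congrFun ht 0
  have e1 := congrFun ht 1
  have e2 := congrFun ht 2
  simp only [fermatVec, Matrix.cons_val_zero, Matrix.cons_val_one, Pi.smul_apply,
    smul_eq_mul, Matrix.cons_val, mul_one] at e0 e1 e2
  have ht0 : t ≠ 0 := by
    rintro rfl
    have : (2 : ℂ) = 0 := by linear_combination -e0 - e1
    norm_num at this
  rw [← e0, ← e1, ← e2]
  exact ⟨hz, ht0, by field_simp, by field_simp⟩

end PeriodPair

end

theorem mainTheorem2 :
    (∃ L : PeriodPair, L.g₂ = 0 ∧ L.g₃ = 8) ∧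
    ∀ L : PeriodPair, L.g₂ = 0 → L.g₃ = 8 →
      (∃ Φ : Diffeomorph 𝓘(ℂ) 𝓘(ℂ) L.Torus FermatCubic ω,
        ∀ z : ℂ, z ∉ L.lattice → L.weierstrassP z ≠ 0 →
          (Φ (L.lattice.mkQ z)).1 = affinePoint
            (1 / L.weierstrassP z - 1 / (√24 : ℝ) * (L.derivWeierstrassP z / L.weierstrassP z))
            (1 / L.weierstrassP z + 1 / (√24 : ℝ) * (L.derivWeierstrassP z / L.weierstrassP z))) ∧
      ∀ F G : ℂ → ℂ, Meromorphic F → Meromorphic G →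
        (∀ᶠ z in codiscrete ℂ, F z ^ 3 + G z ^ 3 = 1) →
        ∃ α : ℂ → ℂ, Differentiable ℂ α ∧ ∀ᶠ z in codiscrete ℂ,
          α z ∉ L.lattice ∧ L.weierstrassP (α z) ≠ 0 ∧
          F z = 1 / L.weierstrassP (α z) *
            (1 - 1 / (√24 : ℝ) * L.derivWeierstrassP (α z)) ∧
          G z = 1 / L.weierstrassP (α z) *
            (1 + 1 / (√24 : ℝ) * L.derivWeierstrassP (α z)) := by
  refine ⟨PeriodPair.exists_g₂_eq_zero_and_g₃_eq, fun L h₂ h₃ ↦ ?_⟩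
  obtain ⟨Φ, hΦ⟩ := PeriodPair.exists_diffeomorph h₂ h₃
  refine ⟨⟨Φ, fun z hz hP ↦ ?_⟩, fun F G hF hG h ↦ ?_⟩
  · rw [hΦ, PeriodPair.toFermat_of_notMem h₂ h₃ hz]
    refine (Projectivization.mk_eq_mk_iff' ℂ _ _ _ _).2 ⟨L.weierstrassP z, ?_⟩
    funext i
    fin_cases i
    · simp [PeriodPair.fermatVec, PeriodPair.invSqrt24]
      field_simp
    · simp [PeriodPair.fermatVec, PeriodPair.invSqrt24]
      field_simp
    · simp [PeriodPair.fermatVec]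
  · obtain ⟨f, hf, hfe⟩ := FermatCubic.exists_contMDiff_of_meromorphic hF hG h
    obtain ⟨α, hα, hαf⟩ := L.exists_differentiable_lift (Φ.symm.contMDiff.comp hf)
    refine ⟨α, hα, ?_⟩
    filter_upwards [hfe] with z ⟨h0, hv, hz⟩
    refine PeriodPair.weierstrassP_ne_zero_and_eq_of_toFermat_eq_mk h₂ h₃ (h0 := h0) (hv := hv) ?_
    rw [← hΦ, hαf, ← hz]
    exact Φ.apply_symm_apply (f z)
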